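/- Consider $N$ agents and fix an agent $i$ whose local trajectory $\tau_i=(x_1,\dots,x_n)$ consists of $n$ transitions. Two trajectories of the same length are neighbouring if they differ in at most one transition. A randomized mechanism $M$ on trajectories is $(\epsilon,\delta)$-DP if $\Pr[M(\tau)\in S]\le e^{\epsilon}\Pr[M(\tau')\in S]+\delta$ for all neighbouring $\tau,\tau'$ and all measurable $S$. Let $\gamma_1,\gamma_2,\beta\in(0,1)$, $C>0$, $\epsilon_i>0$ and $\delta>0$. Agent $i$ has a (possibly stochastic) message function $f_i^s$ that assigns to a subset of the transitions of its trajectory a random vector of $\mathbb R^d$ (for instance a Gaussian or a deterministic one). A privatized message of agent $i$ is generated as follows: $\lfloor\gamma_1 n\rfloor$ of the $n$ transitions are sampled uniformly without replacement; $p$ is drawn from $f_i^s$ applied to the sampled transitions and is clipped to $\bar p=p/\max(1,\|p\|_2/C)$; the message is $m=\bar p+u$ with an independent $u\sim\mathcal N(0,\sigma_i^2\mathbf I_d)$. In one communication step, agent $i$ samples $\lfloor\gamma_2N\rfloor$ of the other agents uniformly without replacement, independently of the messages, and either (a) sends each of them a privatized message, generated independently for each recipient, or (b) generates one privatized message and shares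 it with all of them. The output of the step is the set of recipients together with the messages that they receive. Put $$\alpha=\frac{\log(1/\delta)}{\epsilon_i(1-\beta)}+1,\qquad \sigma_i^2=\frac{14\gamma_2\gamma_1^2NC^2\alpha}{\beta\epsilon_i},\qquad \sigma'^2=\frac{\sigma_i^2}{4C^2},$$ and suppose that $$\sigma'^2\ge 0.7\qquad\text{and}\qquad \alpha\le \frac{2\sigma'^2}{3}\log\frac{1}{\gamma_1\alpha(1+\sigma'^2)}+1 .$$ Then the communication step of agent $i$, as a mechanism on its local trajectory $\tau_i$, is $(\epsilon_i,\delta)$-DP in case (a) and in case (b). -/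

import Mathlib

open MeasureTheory ProbabilityTheory
open scoped ENNReal

noncomputable section

namespace DPMAC

/-- The message space `ℝ^d` with the `ℓ₂` norm. -/
abbrev Msg (d : ℕ) : Type := EuclideanSpace ℝ (Fin d)

/-- A randomized mechanism (a dataset is mapped to the law of the output) is
`(ε, δ)`-differentially private for the neighbouring relation `nbr`. -/
def IsDP {D Y : Type*} [MeasurableSpace Y] (nbr : D → D → Prop) (M : D → Measure Y)
    (ε δ : ℝ) : Prop :=
  ∀ D₁ D₂ : D, nbr D₁ D₂ → ∀ S : Set Y, MeasurableSet S →
    M D₁ S ≤ ENNReal.ofReal (Real.exp ε) * M D₂ S + ENNReal.ofReal δ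

/-- Two trajectories of the same length are neighbours if they differ in (at most) one transition. -/
def Neighbours {n : ℕ} {T : Type*} (τ τ' : Fin n → T) : Prop :=
  ∃ r : Fin n, ∀ t : Fin n, t ≠ r → τ t = τ' t

/-- Norm clipping `v ↦ v / max(1, ‖v‖₂ / C)`. -/
def clip {d : ℕ} (C : ℝ) (v : Msg d) : Msg d :=
  (max 1 (‖v‖ / C))⁻¹ • v

/-- The law obtained by drawing an index uniformly from the finite set `s` and then a point from
the law attached to this index. -/
def uniformMixture {ι Y : Type*} [MeasurableSpace Y] (s : Finset ι) (μ : ι → Measure Y) :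
    Measure Y :=
  (s.card : ℝ≥0∞)⁻¹ • ∑ j ∈ s, μ j

/-- A (stochastic) message function for trajectories of length `n` with transitions in `T`: it
takes a set `J` of sampled time indices together with the transitions at these times, and returns
the law of the raw message. Gaussian laws and Dirac laws (deterministic messages) are
special cases. -/
abbrev MessageFunction (n : ℕ) (T : Type*) (d : ℕ) : Type _ :=
  (J : Finset (Fin n)) → (J → T) → ProbabilityMeasure (Msg d)

/-- The law of one privatized message: sample `⌊γ₁ n⌋` of the `n` transitions uniformly without
replacement, draw the raw message, clip it to norm `C`, and add independent `N(0, v I_d)` noise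
(`v` is the variance). -/
def messageLaw {n d : ℕ} {T : Type*} (f : MessageFunction n T d) (γ₁ C v : ℝ)
    (τ : Fin n → T) : Measure (Msg d) :=
  uniformMixture (Finset.powersetCard ⌊γ₁ * (n : ℝ)⌋₊ Finset.univ) fun J =>
    ((f J fun t => τ t : Measure (Msg d)).map (clip C)) ∗
      multivariateGaussian 0 (v • (1 : Matrix (Fin d) (Fin d) ℝ))

/-- What agents receive in one step: the set of recipients and the message for each of them. -/
abbrev Transcript (N d : ℕ) : Type :=
  (K : Finset (Fin N)) × (K → Msg d)

/-- The possible sets of recipients of agent `i`: sets of `⌊γ₂ N⌋` other agents. -/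
def targetSets {N : ℕ} (i : Fin N) (γ₂ : ℝ) : Finset (Finset (Fin N)) :=
  Finset.powersetCard ⌊γ₂ * (N : ℝ)⌋₊ (Finset.univ.erase i)

/-- One communication step of agent `i` in which the sampled recipients get messages that are
generated independently of each other. -/
def compositeCommunication {N n d : ℕ} {T : Type*} (i : Fin N) (f : MessageFunction n T d)
    (γ₁ γ₂ C v : ℝ) (τ : Fin n → T) : Measure (Transcript N d) :=
  uniformMixture (targetSets i γ₂) fun K =>
    (Measure.pi fun _ : K => messageLaw f γ₁ C v τ).map fun m => (⟨K, m⟩ : Transcript N d)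

/-- One communication step of agent `i` in which one message is generated and shared with all the
sampled recipients. -/
def sharedCommunication {N n d : ℕ} {T : Type*} (i : Fin N) (f : MessageFunction n T d)
    (γ₁ γ₂ C v : ℝ) (τ : Fin n → T) : Measure (Transcript N d) :=
  uniformMixture (targetSets i γ₂) fun K =>
    (messageLaw f γ₁ C v τ).map fun m => (⟨K, fun _ => m⟩ : Transcript N d)

end DPMAC

end

/-! The argument is Rényi privacy amplification by subsampling, done by moments. A sample misses the
changed transition with probability at least `1 - γ₁`, so the two message laws are mixtures `P =
(1-q)A + qB` and `Q = (1-q)A + qB'` with `q ≤ γ₁`, smoothed by the same Gaussian and with clipped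
centres in a ball of radius `C` (`exists_rawMixture_eq`). In the relative deviation `x = dP/dQ - 1`
the common part cancels. By Hölder and convexity of inverse powers, `∫ |x|^n dQ` is at most `γ₁^n`
times a bound for `∫ |r_b - r_b'|^n / r_c^(n-1)`, where `r` denotes likelihood ratios of shifted
Gaussians (`lintegral_relative_deviation_le`). These integrals are controlled explicitly in terms of
`t = 4C²/v = 1/s`.

The first moment of `x` vanishes in signed form. The second is at most `3.5 γ₁² t`. The higher ones
carry extra factors `γ₁`, which by the hypothesis on `α` outweigh the growth of the Gaussian
moments. Expanding `(1+x)^α` gives `∫ (dP/dQ)^α dQ ≤ exp((α-1)κ)` with `κ = 3.5 α γ₁² t`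
(`exists_messageLaw_density_rpow_le`).

For independent messages these moments multiply, so at most `γ₂N` recipients cost `γ₂Nκ`, and the
variance is chosen to make this `βε`. A Markov-type argument (`withDensity_apply_le_exp_mul_add`)
turns the moment bound into approximate domination with additive error `exp(-(α-1)(1-β)ε) = δ`. A
shared message costs only one `κ`. The recipient set is independent of the trajectory, so it
suffices to argue for each set separately. -/

open MeasureTheory ProbabilityTheory
open scoped ENNReal

noncomputable section

namespace DPMAC

/-! ### Gaussian likelihood ratios and their moments. -/

section Gaussian

open scoped RealInnerProductSpace

/-- The centred isotropic Gaussian law with variance `v` in each direction. -/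
abbrev noise (d : ℕ) (v : ℝ) : Measure (Msg d) :=
  multivariateGaussian 0 (v • (1 : Matrix (Fin d) (Fin d) ℝ))

/-- The likelihood ratio of `N(c, v I)` with respect to `N(0, v I)`. -/
def shiftRatio {d : ℕ} (v : ℝ) (c y : Msg d) : ℝ :=
  Real.exp (⟪c, y⟫ / v - ‖c‖ ^ 2 / (2 * v))

variable {d : ℕ} {v : ℝ}

theorem shiftRatio_pos (c y : Msg d) : 0 < shiftRatio v c y := Real.exp_pos _

theorem posSemidef_smul_one (hv : 0 ≤ v) :
    (v • (1 : Matrix (Fin d) (Fin d) ℝ)).PosSemidef :=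
  Matrix.PosSemidef.one.smul hv

theorem map_inner_noise (hv : 0 ≤ v) (t : Msg d) :
    (noise d v).map (fun y => ⟪t, y⟫) = gaussianReal 0 (v * ‖t‖ ^ 2).toNNReal := by
  apply Measure.ext_of_charFun
  ext u
  rw [charFun_gaussianReal]
  have h1 : charFun ((noise d v).map (fun y => ⟪t, y⟫)) u = charFun (noise d v) (u • t) := by
    rw [charFun_apply, charFun_apply, integral_map (by fun_prop) (by fun_prop)]
    congr with y
    simp [real_inner_smul_right, real_inner_comm, mul_comm]
  rw [h1, charFun_multivariateGaussian (posSemidef_smul_one hv)]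
  have h2 : (u • t).ofLp ⬝ᵥ (v • (1 : Matrix (Fin d) (Fin d) ℝ)).mulVec (u • t).ofLp
      = v * ‖t‖ ^ 2 * u ^ 2 := by
    rw [Matrix.smul_mulVec, Matrix.one_mulVec, EuclideanSpace.real_norm_sq_eq]
    simp only [dotProduct, Pi.smul_apply, PiLp.smul_apply, smul_eq_mul, Finset.mul_sum,
      Finset.sum_mul]
    exact Finset.sum_congr rfl fun i _ => by ring
  rw [h2, Real.coe_toNNReal _ (by positivity)]
  simp

theorem integrable_exp_inner_noise (hv : 0 ≤ v) (t : Msg d) :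
    Integrable (fun y => Real.exp ⟪t, y⟫) (noise d v) := by
  have h := integrable_exp_mul_gaussianReal (μ := 0) (v := (v * ‖t‖ ^ 2).toNNReal) 1
  rw [← map_inner_noise hv t, integrable_map_measure (by fun_prop) (by fun_prop)] at h
  simpa [Function.comp_def] using h

theorem integral_exp_inner_noise (hv : 0 ≤ v) (t : Msg d) :
    ∫ y, Real.exp ⟪t, y⟫ ∂(noise d v) = Real.exp (v * ‖t‖ ^ 2 / 2) := by
  have h := mgf_gaussianReal (map_inner_noise hv t) 1
  simpa [mgf, Real.coe_toNNReal _ (show 0 ≤ v * ‖t‖ ^ 2 by positivity)] using h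

theorem integrable_shiftRatio (hv : 0 < v) (c : Msg d) :
    Integrable (shiftRatio v c) (noise d v) := by
  have h := (integrable_exp_inner_noise hv.le (v⁻¹ • c)).mul_const
    (Real.exp (-(‖c‖ ^ 2 / (2 * v))))
  refine h.congr (ae_of_all _ fun y => ?_)
  simp only [shiftRatio, real_inner_smul_left, ← Real.exp_add]
  congr 1
  ring

theorem measurable_shiftRatio_right (c : Msg d) : Measurable (shiftRatio v c) := by
  unfold shiftRatio
  fun_prop

theorem mgf_inner_map_add_noise (hv : 0 ≤ v) (c t : Msg d) (u : ℝ) :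
    mgf (fun y => ⟪t, y⟫) ((noise d v).map fun y => c + y) u =
      Real.exp (u * ⟪t, c⟫ + v * u ^ 2 * ‖t‖ ^ 2 / 2) := by
  rw [mgf, integral_map (by fun_prop) (by fun_prop)]
  have h : ∀ y : Msg d, Real.exp (u * ⟪t, c + y⟫) =
      Real.exp (u * ⟪t, c⟫) * Real.exp ⟪u • t, y⟫ := fun y => by
    rw [← Real.exp_add, inner_add_right, real_inner_smul_left, mul_add]
  simp_rw [h]
  rw [integral_const_mul, integral_exp_inner_noise hv, ← Real.exp_add, norm_smul, mul_pow,
    Real.norm_eq_abs, sq_abs]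
  congr 1
  ring

theorem mgf_inner_withDensity_noise (hv : 0 < v) (c t : Msg d) (u : ℝ) :
    mgf (fun y => ⟪t, y⟫)
        ((noise d v).withDensity fun y => ENNReal.ofReal (shiftRatio v c y)) u =
      Real.exp (u * ⟪t, c⟫ + v * u ^ 2 * ‖t‖ ^ 2 / 2) := by
  rw [mgf, integral_withDensity_eq_integral_toReal_smul
    (measurable_shiftRatio_right c).ennreal_ofReal (by simp)]
  have h : ∀ y : Msg d, (ENNReal.ofReal (shiftRatio v c y)).toReal • Real.exp (u * ⟪t, y⟫) =
      Real.exp (-(‖c‖ ^ 2 / (2 * v))) * Real.exp ⟪v⁻¹ • c + u • t, y⟫ := fun y => by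
    rw [ENNReal.toReal_ofReal (shiftRatio_pos c y).le, smul_eq_mul, shiftRatio, ← Real.exp_add,
      ← Real.exp_add, inner_add_left, real_inner_smul_left, real_inner_smul_left]
    congr 1
    ring
  simp_rw [h]
  rw [integral_const_mul, integral_exp_inner_noise hv.le, ← Real.exp_add, norm_add_sq_real,
    norm_smul, norm_smul, mul_pow, mul_pow, Real.norm_eq_abs, Real.norm_eq_abs, sq_abs, sq_abs,
    real_inner_smul_left, real_inner_smul_right, real_inner_comm]
  congr 1
  field_simp
  ring

theorem charFun_eq_complexMGF_inner (μ : Measure (Msg d)) (t : Msg d) :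
    charFun μ t = complexMGF (fun y => ⟪t, y⟫) μ Complex.I := by
  rw [charFun_apply, complexMGF]
  congr with y
  rw [real_inner_comm, mul_comm]

/-- All linear functionals have the same moment generating function under both measures. Analytic
continuation to the imaginary axis identifies the characteristic functions, hence the measures. -/
theorem map_add_noise (hv : 0 < v) (c : Msg d) :
    (noise d v).map (fun y => c + y) =
      (noise d v).withDensity fun y => ENNReal.ofReal (shiftRatio v c y) := by
  have : IsFiniteMeasure ((noise d v).withDensity fun y => ENNReal.ofReal (shiftRatio v c y)) :=
    isFiniteMeasure_withDensity_ofReal (integrable_shiftRatio hv c).2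
  have : IsProbabilityMeasure ((noise d v).map fun y => c + y) :=
    Measure.isProbabilityMeasure_map (by fun_prop)
  apply Measure.ext_of_charFun
  ext t
  rw [charFun_eq_complexMGF_inner, charFun_eq_complexMGF_inner]
  refine eqOn_complexMGF_of_mgf (funext fun u => ?_) ?_
  · rw [mgf_inner_map_add_noise hv.le, mgf_inner_withDensity_noise hv]
  -- A positive value of the generating function certifies integrability, so the domain of the
  -- continuation is the whole plane and contains `Complex.I`.
  · have h : integrableExpSet (fun y => ⟪t, y⟫) ((noise d v).map fun y => c + y) = Set.univ := by
      refine Set.eq_univ_of_forall fun u => ?_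
      rw [integrableExpSet, Set.mem_ofPred_eq, ← mgf_pos_iff, mgf_inner_map_add_noise hv.le]
      exact Real.exp_pos _
    simp [h]

/-- Exponents are collected in a Gaussian integral of a product of three likelihood ratios. -/
theorem shiftRatio_pow_mul (a b c y : Msg d) (i j : ℕ) (k : ℤ) :
    shiftRatio v a y ^ i * shiftRatio v b y ^ j * shiftRatio v c y ^ k =
      Real.exp (-((i * ‖a‖ ^ 2 + j * ‖b‖ ^ 2 + k * ‖c‖ ^ 2) / (2 * v))) *
        Real.exp ⟪v⁻¹ • ((i : ℝ) • a + (j : ℝ) • b + (k : ℝ) • c), y⟫ := by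
  have h : ∀ x : ℝ, Real.exp x ^ k = Real.exp (k * x) := fun x => by
    rw [mul_comm, Real.exp_mul, Real.rpow_intCast]
  simp only [shiftRatio, ← Real.exp_nat_mul, h, ← Real.exp_add,
    real_inner_smul_left, inner_add_left]
  congr 1
  ring

theorem integrable_shiftRatio_pow_mul (hv : 0 < v) (a b c : Msg d) (i j : ℕ) (k : ℤ) :
    Integrable (fun y => shiftRatio v a y ^ i * shiftRatio v b y ^ j * shiftRatio v c y ^ k)
      (noise d v) := by
  simp_rw [shiftRatio_pow_mul]
  exact (integrable_exp_inner_noise hv.le _).const_mul _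

/-- Completing the square gives a Gaussian exponent. Total degree one makes it translation
invariant, so only differences from `c` survive. -/
theorem integral_shiftRatio_pow_mul (hv : 0 < v) (a b c : Msg d) (i j : ℕ) (k : ℤ)
    (hk : (i + j + k : ℤ) = 1) :
    ∫ y, shiftRatio v a y ^ i * shiftRatio v b y ^ j * shiftRatio v c y ^ k ∂(noise d v) =
      Real.exp ((i * (i - 1) * ‖a - c‖ ^ 2 + j * (j - 1) * ‖b - c‖ ^ 2 +
        2 * i * j * ⟪a - c, b - c⟫) / (2 * v)) := by
  have hk' : (k : ℝ) = 1 - i - j := by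
    have : ((i + j + k : ℤ) : ℝ) = 1 := by rw [hk]; norm_num
    push_cast at this
    linarith
  simp_rw [shiftRatio_pow_mul]
  rw [integral_const_mul, integral_exp_inner_noise hv.le, ← Real.exp_add, hk']
  congr 1
  simp only [norm_smul, mul_pow, ← real_inner_self_eq_norm_sq, inner_add_left, inner_add_right,
    inner_sub_left, inner_sub_right, real_inner_smul_left, real_inner_smul_right, Real.norm_eq_abs,
    abs_inv, inv_pow, sq_abs]
  rw [real_inner_comm b a, real_inner_comm c a, real_inner_comm c b]
  field_simp
  ring

theorem abs_sub_pow_le {x y : ℝ} (hx : 0 ≤ x) (hy : 0 ≤ y) (n : ℕ) :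
    |x - y| ^ n ≤ x ^ n + y ^ n := by
  rcases le_total x y with h | h
  · rw [abs_sub_comm, abs_of_nonneg (sub_nonneg.2 h)]
    exact (pow_le_pow_left₀ (sub_nonneg.2 h) (by linarith) n).trans
      (le_add_of_nonneg_left (pow_nonneg hx n))
  · rw [abs_of_nonneg (sub_nonneg.2 h)]
    exact (pow_le_pow_left₀ (sub_nonneg.2 h) (by linarith) n).trans
      (le_add_of_nonneg_right (pow_nonneg hy n))

theorem lintegral_shiftRatio_pow_div (hv : 0 < v) (a b : Msg d) (n : ℕ) :
    ∫⁻ y, ENNReal.ofReal (shiftRatio v b y ^ (n + 1) / shiftRatio v a y ^ n) ∂(noise d v) =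
      ENNReal.ofReal (Real.exp (n * (n + 1) * ‖b - a‖ ^ 2 / (2 * v))) := by
  have hi := integrable_shiftRatio_pow_mul hv b b a (n + 1) 0 (-n : ℤ)
  have h := integral_shiftRatio_pow_mul hv b b a (n + 1) 0 (-n : ℤ) (by push_cast; ring)
  have he : ∀ y, shiftRatio v b y ^ (n + 1) * shiftRatio v b y ^ 0 * shiftRatio v a y ^ (-n : ℤ) =
      shiftRatio v b y ^ (n + 1) / shiftRatio v a y ^ n := fun y => by
    rw [zpow_neg, zpow_natCast, pow_zero, mul_one, div_eq_mul_inv]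
  simp_rw [he] at hi h
  rw [← ofReal_integral_eq_lintegral_ofReal hi, h]
  · congr 2
    push_cast
    ring
  · exact ae_of_all _ fun y =>
      (div_pos (pow_pos (shiftRatio_pos _ _) _) (pow_pos (shiftRatio_pos _ _) _)).le

/-- The cancellation between `b` and `b'` is given up, so the bound does not vanish with `t`. This
is affordable from the third moment on, where spare powers of `γ` supply the missing factor. -/
theorem lintegral_abs_sub_pow_div_le (hv : 0 < v) {t : ℝ} {a b b' : Msg d}
    (hb : ‖b - a‖ ^ 2 ≤ t * v) (hb' : ‖b' - a‖ ^ 2 ≤ t * v) (n : ℕ) :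
    ∫⁻ y, ENNReal.ofReal (|shiftRatio v b y - shiftRatio v b' y| ^ (n + 1) /
        shiftRatio v a y ^ n) ∂(noise d v) ≤
      ENNReal.ofReal (2 * Real.exp (n * (n + 1) * t / 2)) := by
  have key : ∀ c : Msg d, ‖c - a‖ ^ 2 ≤ t * v →
      ∫⁻ y, ENNReal.ofReal (shiftRatio v c y ^ (n + 1) / shiftRatio v a y ^ n) ∂(noise d v) ≤
        ENNReal.ofReal (Real.exp (n * (n + 1) * t / 2)) := fun c hc => by
    rw [lintegral_shiftRatio_pow_div hv]
    refine ENNReal.ofReal_le_ofReal (Real.exp_le_exp.2 ?_)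
    rw [div_le_div_iff₀ (by positivity) two_pos]
    have : (0 : ℝ) ≤ n * (n + 1) := by positivity
    nlinarith [mul_le_mul_of_nonneg_left hc this]
  have hpos : ∀ c y : Msg d, 0 ≤ shiftRatio v c y ^ (n + 1) / shiftRatio v a y ^ n := fun c y =>
    (div_pos (pow_pos (shiftRatio_pos _ _) _) (pow_pos (shiftRatio_pos _ _) _)).le
  calc _ ≤ ∫⁻ y, (ENNReal.ofReal (shiftRatio v b y ^ (n + 1) / shiftRatio v a y ^ n) +
        ENNReal.ofReal (shiftRatio v b' y ^ (n + 1) / shiftRatio v a y ^ n)) ∂(noise d v) := by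
        refine lintegral_mono fun y => ?_
        rw [← ENNReal.ofReal_add (hpos _ _) (hpos _ _), ← add_div]
        refine ENNReal.ofReal_le_ofReal (div_le_div_of_nonneg_right ?_
          (pow_pos (shiftRatio_pos _ _) _).le)
        exact abs_sub_pow_le (shiftRatio_pos _ _).le (shiftRatio_pos _ _).le _
    _ ≤ _ := by
        have hm : Measurable fun y =>
            ENNReal.ofReal (shiftRatio v b y ^ (n + 1) / shiftRatio v a y ^ n) :=
          (((measurable_shiftRatio_right b).pow_const _).div
            ((measurable_shiftRatio_right a).pow_const _)).ennreal_ofReal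
        rw [lintegral_add_left hm, two_mul, ENNReal.ofReal_add (by positivity) (by positivity)]
        exact add_le_add (key b hb) (key b' hb')

/-- The extremal case is `u = w = t`, `z = t/2`: three centres at maximal mutual distance. After `z`
is replaced by its lower bound `(u + w - t)/2`, the expression increases when first `u` and then `w`
is raised to `t`. -/
theorem exp_add_exp_sub_two_exp_le {t u w z : ℝ} (hu : u ≤ t) (hw : w ≤ t) (hu0 : 0 ≤ u)
    (hw0 : 0 ≤ w) (hz : u + w - 2 * z ≤ t) :
    Real.exp u + Real.exp w - 2 * Real.exp z ≤ 2 * (Real.exp t - Real.exp (t / 2)) := by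
  set U := Real.exp (u / 2) with hU
  set W := Real.exp (w / 2) with hW
  set T := Real.exp (t / 2) with hT
  have e1 : Real.exp u = U ^ 2 := by rw [hU, ← Real.exp_nat_mul]; congr 1; push_cast; ring
  have e2 : Real.exp w = W ^ 2 := by rw [hW, ← Real.exp_nat_mul]; congr 1; push_cast; ring
  have e3 : Real.exp t = T ^ 2 := by rw [hT, ← Real.exp_nat_mul]; congr 1; push_cast; ring
  have e4 : U * W / T ≤ Real.exp z := by
    rw [hU, hW, hT, ← Real.exp_add, ← Real.exp_sub]
    exact Real.exp_le_exp.2 (by linarith)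
  have hT0 : 0 < T := Real.exp_pos _
  have hU1 : 1 ≤ U := Real.one_le_exp (by linarith)
  have hW1 : 1 ≤ W := Real.one_le_exp (by linarith)
  have hUT : U ≤ T := Real.exp_le_exp.2 (by linarith)
  have hWT : W ≤ T := Real.exp_le_exp.2 (by linarith)
  have hq : W / T ≤ 1 := (div_le_one hT0).2 hWT
  have h1 : T ^ 2 + W ^ 2 - 2 * W - (U ^ 2 + W ^ 2 - 2 * (U * W / T)) =
      (T - U) * (T + U - 2 * (W / T)) := by
    field_simp
    ring
  have h2 : 0 ≤ (T - U) * (T + U - 2 * (W / T)) :=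
    mul_nonneg (by linarith) (by linarith)
  have h3 : 0 ≤ (T - W) * (T + W - 2) := mul_nonneg (by linarith) (by linarith)
  rw [e1, e2, e3]
  nlinarith

/-- The chord bound for `exp` on `[0, b]`. -/
theorem exp_le_chord {x b : ℝ} (hb : 0 < b) (h0 : 0 ≤ x) (h1 : x ≤ b) :
    Real.exp x ≤ 1 + x / b * (Real.exp b - 1) := by
  have h := convexOn_exp.2 (Set.mem_univ (0 : ℝ)) (Set.mem_univ b)
    (sub_nonneg.2 ((div_le_one hb).2 h1)) (div_nonneg h0 hb.le) (by ring)
  simp only [smul_eq_mul, mul_zero, zero_add, Real.exp_zero, mul_one,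
    div_mul_cancel₀ _ hb.ne'] at h
  linarith

theorem exp_rat_le {p q : ℕ} (hq : q ≠ 0) {c : ℝ} (hc : 0 ≤ c)
    (h : (2.7182818286 : ℝ) ^ p ≤ c ^ q) :
    Real.exp (p / q) ≤ c := by
  refine le_of_pow_le_pow_left₀ hq hc ?_
  rw [← Real.exp_nat_mul, mul_div_cancel₀ _ (Nat.cast_ne_zero.2 hq)]
  refine le_trans ?_ h
  rw [← mul_one (p : ℝ), Real.exp_nat_mul]
  exact pow_le_pow_left₀ (Real.exp_pos _).le Real.exp_one_lt_d9.le _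

theorem exp_sub_exp_half_le {t : ℝ} (h0 : 0 ≤ t) (h1 : t ≤ 10 / 7) :
    2 * (Real.exp t - Real.exp (t / 2)) ≤ 3.5 * t := by
  have h5 : Real.exp (5 / 7) ≤ 2.1 := by
    have := exp_rat_le (p := 5) (q := 7) (by norm_num) (c := 2.1) (by norm_num) (by norm_num)
    simpa using this
  have hc := exp_le_chord (x := t / 2) (b := 5 / 7) (by norm_num) (by linarith) (by linarith)
  have e3 : Real.exp t = Real.exp (t / 2) ^ 2 := by
    rw [← Real.exp_nat_mul]; congr 1; push_cast; ring
  have hc1 : Real.exp (t / 2) - 1 ≤ 0.77 * t := by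
    have : t / 2 / (5 / 7) * (Real.exp (5 / 7) - 1) ≤ t / 2 / (5 / 7) * (2.1 - 1) :=
      mul_le_mul_of_nonneg_left (by linarith) (by positivity)
    nlinarith
  have hc2 : Real.exp (t / 2) ≤ 2.1 := by linarith
  have hc3 : 1 ≤ Real.exp (t / 2) := Real.one_le_exp (by linarith)
  rw [e3]
  nlinarith [mul_le_mul hc2 hc1 (by linarith) (by norm_num)]

/-- The second moment has no spare power of `γ`, so it must itself be linear in `t`; hence the
square is expanded exactly and the cross term kept. -/
theorem lintegral_sub_sq_div_le (hv : 0 < v) {t : ℝ} (ht1 : t ≤ 10 / 7)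
    {a b b' : Msg d} (hb : ‖b - a‖ ^ 2 ≤ t * v) (hb' : ‖b' - a‖ ^ 2 ≤ t * v)
    (hbb' : ‖b - b'‖ ^ 2 ≤ t * v) :
    ∫⁻ y, ENNReal.ofReal (|shiftRatio v b y - shiftRatio v b' y| ^ 2 / shiftRatio v a y ^ 1)
      ∂(noise d v) ≤ ENNReal.ofReal (3.5 * t) := by
  have ht0 : 0 ≤ t := nonneg_of_mul_nonneg_left ((sq_nonneg _).trans hb) hv
  have i1 := integrable_shiftRatio_pow_mul hv b b' a 2 0 (-1)
  have i2 := integrable_shiftRatio_pow_mul hv b b' a 0 2 (-1)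
  have i3 := integrable_shiftRatio_pow_mul hv b b' a 1 1 (-1)
  have he : ∀ y, |shiftRatio v b y - shiftRatio v b' y| ^ 2 / shiftRatio v a y ^ 1 =
      shiftRatio v b y ^ 2 * shiftRatio v b' y ^ 0 * shiftRatio v a y ^ (-1 : ℤ) +
      shiftRatio v b y ^ 0 * shiftRatio v b' y ^ 2 * shiftRatio v a y ^ (-1 : ℤ) -
      2 * (shiftRatio v b y ^ 1 * shiftRatio v b' y ^ 1 * shiftRatio v a y ^ (-1 : ℤ)) :=
    fun y => by
    rw [sq_abs, zpow_neg_one]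
    have := (shiftRatio_pos (v := v) a y).ne'
    field_simp
    ring
  rw [← ofReal_integral_eq_lintegral_ofReal]
  · refine ENNReal.ofReal_le_ofReal ?_
    simp_rw [he]
    rw [integral_sub (i1.fun_add i2) (i3.const_mul 2), integral_add i1 i2, integral_const_mul,
      integral_shiftRatio_pow_mul hv _ _ _ _ _ _ (by norm_num),
      integral_shiftRatio_pow_mul hv _ _ _ _ _ _ (by norm_num),
      integral_shiftRatio_pow_mul hv _ _ _ _ _ _ (by norm_num)]
    refine le_trans ?_ (exp_sub_exp_half_le ht0 ht1)
    refine exp_add_exp_sub_two_exp_le ?_ ?_ ?_ ?_ ?_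
    · rw [div_le_iff₀ (by positivity)]; push_cast; nlinarith
    · rw [div_le_iff₀ (by positivity)]; push_cast; nlinarith
    · push_cast; norm_num; positivity
    · push_cast; norm_num; positivity
    · have h : ‖b - b'‖ ^ 2 = ‖b - a‖ ^ 2 + ‖b' - a‖ ^ 2 - 2 * ⟪b - a, b' - a⟫ := by
        rw [← sub_sub_sub_cancel_right b b' a, norm_sub_sq_real]
        ring
      rw [h] at hbb'
      rw [← div_le_iff₀ hv] at hbb'
      refine le_trans (le_of_eq ?_) hbb'
      push_cast
      field_simp
      ring
  · simp_rw [he]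
    exact (i1.fun_add i2).sub (i3.const_mul 2)
  · exact ae_of_all _ fun y => div_nonneg (by positivity) (pow_pos (shiftRatio_pos _ _) _).le

end Gaussian

/-! ### Expansion of `(1 + x)^α` and summation of the moment bounds. -/

theorem one_add_pow_mul_expand (m : ℕ) (p x : ℝ) :
    (1 + x) ^ m * (1 + p * x) = 1 + (m + p) * x +
      ∑ n ∈ Finset.range m, (m.choose (n + 2) + p * m.choose (n + 1)) * x ^ (n + 2) := by
  have h1 : (1 + x) ^ m = 1 + m * x + ∑ n ∈ Finset.range m, m.choose (n + 2) * x ^ (n + 2) := by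
    have h : (1 + x) ^ m = ∑ n ∈ Finset.range (m + 2), m.choose n * x ^ n := by
      rw [Finset.sum_range_succ, add_comm 1 x, add_pow]
      simp [mul_comm]
    rw [h, Finset.sum_range_succ', Finset.sum_range_succ']
    simp
    ring
  have h2 : x * (1 + x) ^ m =
      x + ∑ n ∈ Finset.range m, m.choose (n + 1) * x ^ (n + 2) := by
    have h : (1 + x) ^ m = ∑ n ∈ Finset.range (m + 1), m.choose n * x ^ n := by
      rw [add_comm 1 x, add_pow]
      simp [mul_comm]
    rw [h, Finset.sum_range_succ', mul_add, Finset.mul_sum]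
    simp only [Nat.choose_zero_right, Nat.cast_one, pow_zero, mul_one]
    rw [add_comm]
    congr 1
    exact Finset.sum_congr rfl fun n _ => by ring
  calc (1 + x) ^ m * (1 + p * x) = (1 + x) ^ m + p * (x * (1 + x) ^ m) := by ring
    _ = _ := by
      rw [h2, h1, mul_add, Finset.mul_sum]
      simp only [add_mul, Finset.sum_add_distrib, mul_assoc]
      ring

/-- Bernoulli's inequality treats the fractional part of the exponent and the binomial theorem the
integer part, so the sum stays finite for real exponents. The linear term keeps its sign because it
will integrate to zero. -/
theorem one_add_rpow_le {m : ℕ} {p x : ℝ} (hp0 : 0 ≤ p) (hp1 : p ≤ 1) (hx : -1 ≤ x) :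
    (1 + x) ^ ((m : ℝ) + p) ≤ 1 + (m + p) * x +
      ∑ n ∈ Finset.range m, (m.choose (n + 2) + p * m.choose (n + 1)) * |x| ^ (n + 2) := by
  have h0 : 0 ≤ 1 + x := by linarith
  calc (1 + x) ^ ((m : ℝ) + p) = (1 + x) ^ m * (1 + x) ^ p := by
        rw [Real.rpow_add_of_nonneg h0 (by positivity) hp0, Real.rpow_natCast]
    _ ≤ (1 + x) ^ m * (1 + p * x) := mul_le_mul_of_nonneg_left
        (rpow_one_add_le_one_add_mul_self hx hp0 hp1) (by positivity)
    _ ≤ _ := by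
        rw [one_add_pow_mul_expand]
        refine add_le_add_right (Finset.sum_le_sum fun n _ => ?_) _
        refine mul_le_mul_of_nonneg_left ?_ (by positivity)
        rw [← abs_pow]
        exact le_abs_self _

/-- This extends `m.choose k ≤ m^k / k!` to the real exponent `m + p`, by Bernoulli's inequality for
`(1 + p/m)^(n+1)`. -/
theorem choose_add_mul_choose_le {m : ℕ} (hm : 0 < m) {p : ℝ} (hp : 0 ≤ p) (n : ℕ) :
    (m.choose (n + 1) + p * m.choose n : ℝ) ≤ (m + p) ^ (n + 1) / (n + 1).factorial := by
  have h1 := Nat.choose_le_pow_div (α := ℝ) (n + 1) m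
  have h2 := Nat.choose_le_pow_div (α := ℝ) n m
  have hm' : (0 : ℝ) < m := by exact_mod_cast hm
  have hB := one_add_mul_le_pow (a := p / m) (by have := div_nonneg hp hm'.le; linarith) (n + 1)
  have h3 : (m : ℝ) ^ (n + 1) + (n + 1) * p * m ^ n ≤ (m + p) ^ (n + 1) := by
    have := mul_le_mul_of_nonneg_left hB (pow_pos hm' (n + 1)).le
    rw [← mul_pow, mul_add, mul_one, mul_add, mul_one, mul_div_cancel₀ _ hm'.ne'] at this
    refine le_trans (le_of_eq ?_) this
    push_cast
    field_simp
    ring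
  calc (m.choose (n + 1) + p * m.choose n : ℝ)
      ≤ m ^ (n + 1) / (n + 1).factorial + p * (m ^ n / n.factorial) := by gcongr
    _ = (m ^ (n + 1) + (n + 1) * p * m ^ n) / (n + 1).factorial := by
      rw [Nat.factorial_succ]
      push_cast
      have : (n.factorial : ℝ) ≠ 0 := by positivity
      field_simp
    _ ≤ _ := by gcongr

/-- The full series is `e - 5/2 < 0.219`. -/
theorem sum_inv_factorial_le (m : ℕ) :
    ∑ n ∈ Finset.range m, (1 / (n + 3).factorial : ℝ) ≤ 0.219 := by
  have h := Real.sum_le_exp_of_nonneg (x := 1) zero_le_one (m + 3)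
  rw [Finset.sum_range_succ', Finset.sum_range_succ', Finset.sum_range_succ'] at h
  simp only [one_pow, Nat.factorial] at h ⊢
  have := Real.exp_one_lt_d9
  norm_num at h ⊢
  linarith

theorem exp_three_halves_le {t : ℝ} (h0 : 0 ≤ t) (h1 : t ≤ 10 / 7) :
    Real.exp (3 * t / 2) ≤ 4 * (1 + t) := by
  have h5 : Real.exp (15 / 7) ≤ 9 := by
    have := exp_rat_le (p := 15) (q := 7) (by norm_num) (c := 9) (by norm_num) (by norm_num)
    simpa using this
  have hc := exp_le_chord (x := 3 * t / 2) (b := 15 / 7) (by norm_num) (by linarith)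
    (by linarith)
  have : 3 * t / 2 / (15 / 7) * (Real.exp (15 / 7) - 1) ≤ 3 * t / 2 / (15 / 7) * (9 - 1) :=
    mul_le_mul_of_nonneg_left (by linarith) (by positivity)
  linarith

/-- Upper bound for the `n`-th absolute moment of the relative density deviation. -/
def momentBound (γ t : ℝ) : ℕ → ℝ
  | 2 => γ ^ 2 * (3.5 * t)
  | n => γ ^ n * (2 * Real.exp ((n - 1) * n * t / 2))

theorem momentBound_nonneg {γ t : ℝ} (hγ : 0 ≤ γ) (ht : 0 ≤ t) (n : ℕ) :
    0 ≤ momentBound γ t n := by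
  unfold momentBound
  split <;> positivity

/-- Of the `n + 3` factors `γα`, two are kept. The other `n + 1` give one factor `t` and a decay
`exp(-3(n+1)(α-1)t/2)`, which beats the Gaussian growth `exp((n+2)(n+3)t/2)`. -/
theorem mul_momentBound_le {γ t α : ℝ} (hγ : 0 < γ) (ht : 0 < t) (hα : 3 ≤ α) {n : ℕ}
    (hn : n + 1 ≤ α - 1) (hc : γ * α * (1 + 1 / t) ≤ Real.exp (-(3 * (α - 1) * t / 2))) :
    α ^ (n + 3) * momentBound γ t (n + 3) ≤ 2 * (γ * α) ^ 2 * t := by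
  have hx : γ * α ≤ t * Real.exp (-(3 * (α - 1) * t / 2)) / (1 + t) := by
    rw [le_div_iff₀ (by positivity)]
    have := mul_le_mul_of_nonneg_left hc ht.le
    refine le_trans (le_of_eq ?_) this
    field_simp
    ring
  set e := Real.exp (-(3 * (α - 1) * t / 2)) with he
  have he0 : 0 < e := Real.exp_pos _
  have h1 : (γ * α) ^ (n + 1) ≤ t * e ^ (n + 1) := by
    have hγα : γ * α ≤ e := hx.trans <| by
      rw [div_le_iff₀ (by positivity)]
      nlinarith
    have hγα' : γ * α ≤ t * e := hx.trans (div_le_self (by positivity) (by linarith))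
    rw [pow_succ, pow_succ]
    calc (γ * α) ^ n * (γ * α) ≤ e ^ n * (t * e) := by gcongr
      _ = _ := by ring
  have h2 : e ^ (n + 1) * Real.exp (((n + 3 : ℕ) - 1) * (n + 3 : ℕ) * t / 2) ≤ 1 := by
    rw [he, ← Real.exp_nat_mul, ← Real.exp_add, Real.exp_le_one_iff]
    push_cast
    -- The constant 3 in the hypothesis on `α` is tight here: equality holds at `n = 0`, `α = 3` and
    -- at `n = 1`, `α - 1 = 2`.
    have h : ((n : ℝ) + 2) * (n + 3) ≤ 3 * (n + 1) * (α - 1) := by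
      rcases Nat.eq_zero_or_pos n with rfl | h
      · norm_num; linarith
      · have : (1 : ℝ) ≤ n := by exact_mod_cast h
        nlinarith
    nlinarith [mul_le_mul_of_nonneg_right h ht.le]
  calc α ^ (n + 3) * momentBound γ t (n + 3)
      = 2 * (γ * α) ^ 2 * ((γ * α) ^ (n + 1) *
        Real.exp (((n + 3 : ℕ) - 1) * (n + 3 : ℕ) * t / 2)) := by
        simp only [momentBound]
        ring
    _ ≤ 2 * (γ * α) ^ 2 * ((t * e ^ (n + 1)) *
        Real.exp (((n + 3 : ℕ) - 1) * (n + 3 : ℕ) * t / 2)) := by gcongr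
    _ = 2 * (γ * α) ^ 2 * t * (e ^ (n + 1) *
        Real.exp (((n + 3 : ℕ) - 1) * (n + 3 : ℕ) * t / 2)) := by ring
    _ ≤ 2 * (γ * α) ^ 2 * t * 1 := by gcongr
    _ = _ := mul_one _

theorem sum_coeff_mul_momentBound_le {γ t p : ℝ} {m : ℕ} (hγ : 0 < γ) (ht : 0 < t)
    (ht1 : t ≤ 10 / 7) (hm : 1 ≤ m) (hp0 : 0 ≤ p)
    (hc : γ * (m + p) * (1 + 1 / t) ≤ Real.exp (-(3 * (m + p - 1) * t / 2))) :
    ∑ n ∈ Finset.range m, (m.choose (n + 2) + p * m.choose (n + 1)) * momentBound γ t (n + 2) ≤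
      3.5 * (m + p) * (m + p - 1) * γ ^ 2 * t := by
  have hγt : 0 < γ ^ 2 * t := by positivity
  -- Absorbing the third moment by `mul_momentBound_le` needs `α ≥ 3`. For `m = 1` there is no third
  -- moment; for `m = 2` there is one, with coefficient `p`, bounded by hand.
  obtain rfl | rfl | h3 : m = 1 ∨ m = 2 ∨ 3 ≤ m := by omega
  · simp [momentBound]
    nlinarith [mul_nonneg hp0 hγt.le, mul_nonneg hp0 (mul_nonneg hp0 hγt.le)]
  · have hg : γ * Real.exp (3 * t) ≤ 2 * t := by
      have h1 : γ * 2 * (1 + 1 / t) ≤ Real.exp (-(3 * t / 2)) := by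
        push_cast at hc
        refine le_trans ?_ (hc.trans (Real.exp_le_exp.2 ?_))
        · gcongr; linarith
        · nlinarith [mul_nonneg hp0 ht.le]
      have h2 : γ * 2 * (1 + t) ≤ t * Real.exp (-(3 * t / 2)) := by
        refine le_trans (le_of_eq ?_) (mul_le_mul_of_nonneg_left h1 ht.le)
        field_simp
        ring
      have h3 := exp_three_halves_le ht.le ht1
      have h4 : Real.exp (3 * t) = Real.exp (3 * t / 2) * Real.exp (3 * t / 2) := by
        rw [← Real.exp_add]; congr 1; ring
      have h5 : Real.exp (-(3 * t / 2)) * Real.exp (3 * t / 2) = 1 := by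
        rw [← Real.exp_add]; simp
      have h6 : γ * (1 + t) * Real.exp (3 * t) ≤ 2 * t * (1 + t) := by
        calc γ * (1 + t) * Real.exp (3 * t) =
            (γ * 2 * (1 + t)) * Real.exp (3 * t / 2) * Real.exp (3 * t / 2) / 2 := by
              rw [h4]; ring
          _ ≤ (t * Real.exp (-(3 * t / 2))) * Real.exp (3 * t / 2) * (4 * (1 + t)) / 2 := by
              gcongr
          _ = t * (Real.exp (-(3 * t / 2)) * Real.exp (3 * t / 2)) * (4 * (1 + t)) / 2 := by ring
          _ = _ := by rw [h5]; ring
      have : 0 < 1 + t := by linarith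
      refine le_of_mul_le_mul_right ?_ this
      linarith
    have hK : momentBound γ t 3 ≤ 4 * (γ ^ 2 * t) := by
      have : momentBound γ t 3 = 2 * γ ^ 2 * (γ * Real.exp (3 * t)) := by
        simp only [momentBound]
        rw [show ((3 : ℕ) - 1 : ℝ) * (3 : ℕ) * t / 2 = 3 * t by push_cast; ring]
        ring
      rw [this]
      nlinarith [mul_le_mul_of_nonneg_left hg (sq_nonneg γ)]
    rw [Finset.sum_range_succ, Finset.sum_range_one]
    have h2 : momentBound γ t 2 = γ ^ 2 * (3.5 * t) := rfl
    simp only [zero_add, Nat.reduceAdd, h2]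
    norm_num [Nat.choose]
    have := mul_le_mul_of_nonneg_left hK hp0
    nlinarith [mul_nonneg (mul_nonneg hp0 hp0) hγt.le, mul_nonneg (sq_nonneg (1 - p)) hγt.le,
      mul_nonneg hp0 hγt.le]
  · obtain ⟨k, rfl⟩ : ∃ k, m = k + 1 := ⟨m - 1, by omega⟩
    set α : ℝ := ((k + 1 : ℕ) : ℝ) + p with hα
    have hk : (2 : ℝ) ≤ k := by exact_mod_cast (by omega : 2 ≤ k)
    have hα3 : 3 ≤ α := by rw [hα]; push_cast; linarith
    rw [Finset.sum_range_succ']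
    have hz : (((k + 1).choose (0 + 2) : ℝ) + p * (k + 1).choose (0 + 1)) *
        momentBound γ t (0 + 2) ≤ α ^ 2 / 2 * (γ ^ 2 * (3.5 * t)) := by
      have := choose_add_mul_choose_le (m := k + 1) (by omega) hp0 1
      refine mul_le_mul_of_nonneg_right ?_ (momentBound_nonneg hγ.le ht.le 2)
      simpa [hα] using this
    have hr : ∑ n ∈ Finset.range k, (((k + 1).choose (n + 1 + 2) : ℝ) +
        p * (k + 1).choose (n + 1 + 1)) * momentBound γ t (n + 1 + 2) ≤
        ∑ n ∈ Finset.range k, (1 / (n + 3).factorial : ℝ) * (2 * (γ * α) ^ 2 * t) := by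
      refine Finset.sum_le_sum fun n hn => ?_
      have hn' : (n : ℝ) + 1 ≤ k := by exact_mod_cast Finset.mem_range.1 hn
      have h1 := choose_add_mul_choose_le (m := k + 1) (by omega) hp0 (n + 2)
      have h2 := mul_momentBound_le hγ ht hα3 (n := n) (by rw [hα]; push_cast; linarith) hc
      calc _ ≤ α ^ (n + 2 + 1) / (n + 2 + 1).factorial * momentBound γ t (n + 1 + 2) :=
            mul_le_mul_of_nonneg_right h1 (momentBound_nonneg hγ.le ht.le _)
        _ = 1 / (n + 3).factorial * (α ^ (n + 3) * momentBound γ t (n + 3)) := by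
            rw [show n + 1 + 2 = n + 3 by ring, show n + 2 + 1 = n + 3 by ring]; ring
        _ ≤ _ := by gcongr
    rw [← Finset.sum_mul] at hr
    have hs := mul_le_mul_of_nonneg_right (sum_inv_factorial_le k)
      (show 0 ≤ 2 * (γ * α) ^ 2 * t by positivity)
    -- Here `2.188 = 3.5/2 + 2 · 0.219` collects the second moment and the tail; `α ≥ 3` leaves
    -- room.
    have hfin : α * (γ ^ 2 * t) * (2.188 * α) ≤ α * (γ ^ 2 * t) * (3.5 * (α - 1)) := by
      refine mul_le_mul_of_nonneg_left ?_ (by positivity)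
      linarith
    linarith

/-- From moment bounds on the relative density deviation `x` to a bound on the `α`-th moment of
the density `1 + x`. -/
theorem lintegral_one_add_rpow_le {Y : Type*} [MeasurableSpace Y] {Q : Measure Y}
    [IsProbabilityMeasure Q] {x : Y → ℝ} (hxm : Measurable x) (hx : ∀ y, -1 ≤ x y)
    (hx1 : ∫⁻ y, ENNReal.ofReal (1 + x y) ∂Q = 1) {γ t α : ℝ} (hγ : 0 < γ) (ht : 0 < t)
    (ht1 : t ≤ 10 / 7) (hα : 1 < α)
    (hc : γ * α * (1 + 1 / t) ≤ Real.exp (-(3 * (α - 1) * t / 2)))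
    (hM : ∀ n, ∫⁻ y, ENNReal.ofReal (|x y| ^ (n + 2)) ∂Q ≤
      ENNReal.ofReal (momentBound γ t (n + 2))) :
    ∫⁻ y, ENNReal.ofReal ((1 + x y) ^ α) ∂Q ≤
      ENNReal.ofReal (Real.exp (3.5 * α * (α - 1) * γ ^ 2 * t)) := by
  obtain ⟨m, p, hm, hp0, hp1, rfl⟩ : ∃ (m : ℕ) (p : ℝ), 1 ≤ m ∧ 0 ≤ p ∧ p ≤ 1 ∧ α = m + p := by
    refine ⟨⌊α⌋₊, α - ⌊α⌋₊, Nat.one_le_floor_iff _ |>.2 hα.le, ?_, ?_, by ring⟩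
    · linarith [Nat.floor_le (by linarith : 0 ≤ α)]
    · linarith [Nat.lt_floor_add_one α]
  set α : ℝ := m + p with hαdef
  set c : ℕ → ℝ := fun n => m.choose (n + 2) + p * m.choose (n + 1) with hcdef
  have hc0 : ∀ n, 0 ≤ c n := fun n => by positivity
  -- The affine part `1 + αx` is written as `α(1 + x) - (α - 1)` and the constant moved to the left,
  -- so that all terms are nonnegative and `∫ (1 + x) = 1` applies.
  have hpt : ∀ y, ENNReal.ofReal ((1 + x y) ^ α) + ENNReal.ofReal (α - 1) ≤
      ENNReal.ofReal α * ENNReal.ofReal (1 + x y) +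
        ∑ n ∈ Finset.range m, ENNReal.ofReal (c n) * ENNReal.ofReal (|x y| ^ (n + 2)) := fun y => by
    have h0 : 0 ≤ 1 + x y := by linarith [hx y]
    have h := one_add_rpow_le (m := m) hp0 hp1 (hx y)
    have hs : ∑ n ∈ Finset.range m, ENNReal.ofReal (c n) * ENNReal.ofReal (|x y| ^ (n + 2)) =
        ENNReal.ofReal (∑ n ∈ Finset.range m, c n * |x y| ^ (n + 2)) := by
      rw [ENNReal.ofReal_sum_of_nonneg fun n _ => mul_nonneg (hc0 n) (by positivity)]
      exact Finset.sum_congr rfl fun n _ => (ENNReal.ofReal_mul (hc0 n)).symm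
    rw [hs, ← ENNReal.ofReal_mul (by linarith), ← ENNReal.ofReal_add (by positivity) (by linarith),
      ← ENNReal.ofReal_add (mul_nonneg (by linarith) h0)
        (Finset.sum_nonneg fun n _ => mul_nonneg (hc0 n) (by positivity))]
    refine ENNReal.ofReal_le_ofReal ?_
    linarith
  have hmain := lintegral_mono (μ := Q) hpt
  rw [lintegral_add_right _ measurable_const, lintegral_add_left (by fun_prop),
    lintegral_const_mul _ (by fun_prop), hx1, lintegral_finsetSum _ (by fun_prop)] at hmain
  have hsum : ∑ n ∈ Finset.range m,
      ∫⁻ y, ENNReal.ofReal (c n) * ENNReal.ofReal (|x y| ^ (n + 2)) ∂Q ≤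
      ENNReal.ofReal (3.5 * α * (α - 1) * γ ^ 2 * t) := by
    refine le_trans ?_ (ENNReal.ofReal_le_ofReal
      (sum_coeff_mul_momentBound_le hγ ht ht1 hm hp0 hc))
    rw [ENNReal.ofReal_sum_of_nonneg fun n _ =>
      mul_nonneg (hc0 n) (momentBound_nonneg hγ.le ht.le _)]
    refine Finset.sum_le_sum fun n _ => ?_
    rw [lintegral_const_mul _ (by fun_prop), ENNReal.ofReal_mul (hc0 n)]
    gcongr
    exact hM n
  simp only [lintegral_const, measure_univ, mul_one] at hmain
  have hb : (0 : ℝ) ≤ 3.5 * α * (α - 1) * γ ^ 2 * t := by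
    have : 0 ≤ α - 1 := by linarith
    positivity
  have hfin : ∫⁻ y, ENNReal.ofReal ((1 + x y) ^ α) ∂Q + ENNReal.ofReal (α - 1) ≤
      ENNReal.ofReal (1 + 3.5 * α * (α - 1) * γ ^ 2 * t) + ENNReal.ofReal (α - 1) := by
    refine (hmain.trans (add_le_add_right hsum _)).trans (le_of_eq ?_)
    rw [← ENNReal.ofReal_add (by linarith) hb, ← ENNReal.ofReal_add (by linarith) (by linarith)]
    congr 1
    ring
  refine (ENNReal.le_of_add_le_add_right ENNReal.ofReal_ne_top hfin).trans
    (ENNReal.ofReal_le_ofReal ?_)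
  linarith [Real.add_one_le_exp (3.5 * α * (α - 1) * γ ^ 2 * t)]

/-! ### Relative deviation of two Gaussian mixtures with a common component. -/

section GaussianMixture

/-- Hölder's inequality in the form of joint convexity of `(u, w) ↦ u ^ (n + 1) / w ^ n`. -/
theorem lintegral_pow_succ_le {Ω : Type*} [MeasurableSpace Ω] {ρ : Measure Ω}
    {u w : Ω → ℝ≥0∞} (hu : Measurable u) (hw : Measurable w)
    (hw0 : ∀ ω, w ω ≠ 0) (hwt : ∀ ω, w ω ≠ ∞) (n : ℕ) :
    (∫⁻ ω, u ω ∂ρ) ^ (n + 1) ≤ (∫⁻ ω, u ω ^ (n + 1) / w ω ^ n ∂ρ) * (∫⁻ ω, w ω ∂ρ) ^ n := by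
  have hn : (n + 1 : ℝ) ≠ 0 := by positivity
  have h := ENNReal.lintegral_mul_norm_pow_le (μ := ρ) (p := 1 / (n + 1)) (q := n / (n + 1))
    ((hu.pow_const (n + 1)).div (hw.pow_const n)).aemeasurable hw.aemeasurable
    (by positivity) (by positivity) (by field_simp; ring)
  have he : ∀ ω, (u ω ^ (n + 1) / w ω ^ n) ^ (1 / (n + 1) : ℝ) * w ω ^ (n / (n + 1) : ℝ) = u ω :=
    fun ω => by
    have h1 : w ω ^ (n / (n + 1) : ℝ) = (w ω ^ n) ^ (1 / (n + 1) : ℝ) := by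
      rw [← ENNReal.rpow_natCast, ← ENNReal.rpow_mul, mul_one_div]
    rw [h1, ← ENNReal.mul_rpow_of_nonneg _ _ (by positivity),
      ENNReal.div_mul_cancel (pow_ne_zero _ (hw0 ω)) (ENNReal.pow_ne_top (hwt ω)),
      ← ENNReal.rpow_natCast, ← ENNReal.rpow_mul]
    push_cast
    rw [mul_one_div_cancel hn, ENNReal.rpow_one]
  simp only [Pi.div_apply, he] at h
  refine (pow_le_pow_left₀ zero_le h (n + 1)).trans (le_of_eq ?_)
  rw [mul_pow, ← ENNReal.rpow_natCast, ← ENNReal.rpow_natCast, ← ENNReal.rpow_mul,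
    ← ENNReal.rpow_mul]
  push_cast
  rw [one_div_mul_cancel hn, div_mul_cancel₀ _ hn, ENNReal.rpow_one, ENNReal.rpow_natCast]

theorem inv_pow_mixture_le {q x y : ℝ} (hq0 : 0 ≤ q) (hq1 : q ≤ 1) (hx : 0 < x) (hy : 0 < y)
    (n : ℕ) : (((1 - q) * x + q * y) ^ n)⁻¹ ≤ (1 - q) * (x ^ n)⁻¹ + q * (y ^ n)⁻¹ := by
  have h := (convexOn_zpow (𝕜 := ℝ) (-n : ℤ)).2 hx hy (sub_nonneg.2 hq1) hq0 (by ring)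
  simpa [zpow_neg] using h

variable {d : ℕ} {v : ℝ}

/-- The density, with respect to the Gaussian noise, of the mixture of two randomly shifted
Gaussian laws. -/
def mixtureDensity {Ω : Type*} [MeasurableSpace Ω] (ρ : Measure Ω) (v q : ℝ) (a b : Ω → Msg d)
    (y : Msg d) : ℝ :=
  ∫ ω, (1 - q) * shiftRatio v (a ω) y + q * shiftRatio v (b ω) y ∂ρ

variable {Ω : Type*} [MeasurableSpace Ω] {ρ : Measure Ω} [IsProbabilityMeasure ρ] {q C : ℝ}
  {a b b' : Ω → Msg d}

theorem measurable_shiftRatio_comp (ha : Measurable a) :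
    Measurable fun z : Ω × Msg d => shiftRatio v (a z.1) z.2 := by
  unfold shiftRatio
  fun_prop

theorem measurable_shiftRatio_left (ha : Measurable a) (y : Msg d) :
    Measurable fun ω => shiftRatio v (a ω) y := by
  unfold shiftRatio
  fun_prop

theorem integrable_shiftRatio_left (hv : 0 < v) (ha : Measurable a) (haC : ∀ ω, ‖a ω‖ ≤ C)
    (y : Msg d) : Integrable (fun ω => shiftRatio v (a ω) y) ρ := by
  refine Integrable.of_bound (measurable_shiftRatio_left ha y).aestronglyMeasurable
    (Real.exp (C * ‖y‖ / v)) (ae_of_all _ fun ω => ?_)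
  rw [Real.norm_of_nonneg (shiftRatio_pos _ _).le, shiftRatio, Real.exp_le_exp]
  have h1 : inner ℝ (a ω) y ≤ C * ‖y‖ :=
    (real_inner_le_norm _ _).trans (mul_le_mul_of_nonneg_right (haC ω) (norm_nonneg y))
  have h2 : inner ℝ (a ω) y / v ≤ C * ‖y‖ / v := div_le_div_of_nonneg_right h1 hv.le
  have h3 : 0 ≤ ‖a ω‖ ^ 2 / (2 * v) := by positivity
  linarith

theorem integrable_mixture (hv : 0 < v) (ha : Measurable a) (haC : ∀ ω, ‖a ω‖ ≤ C)
    (hb : Measurable b) (hbC : ∀ ω, ‖b ω‖ ≤ C) (y : Msg d) :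
    Integrable (fun ω => (1 - q) * shiftRatio v (a ω) y + q * shiftRatio v (b ω) y) ρ :=
  ((integrable_shiftRatio_left hv ha haC y).const_mul _).add
    ((integrable_shiftRatio_left hv hb hbC y).const_mul _)

theorem mixture_pos (hq0 : 0 ≤ q) (hq1 : q ≤ 1) (a b y : Msg d) :
    0 < (1 - q) * shiftRatio v a y + q * shiftRatio v b y := by
  have h1 := shiftRatio_pos (v := v) a y
  have h2 := shiftRatio_pos (v := v) b y
  rcases hq0.eq_or_lt with rfl | h
  · simpa using h1
  · have := mul_pos h h2
    have := mul_nonneg (sub_nonneg.2 hq1) h1.le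
    linarith

theorem mixtureDensity_pos (hv : 0 < v) (hq0 : 0 ≤ q) (hq1 : q ≤ 1) (ha : Measurable a)
    (haC : ∀ ω, ‖a ω‖ ≤ C) (hb : Measurable b) (hbC : ∀ ω, ‖b ω‖ ≤ C) (y : Msg d) :
    0 < mixtureDensity ρ v q a b y := by
  refine (integral_pos_iff_support_of_nonneg (fun ω => (mixture_pos hq0 hq1 _ _ y).le)
    (integrable_mixture hv ha haC hb hbC y)).2 ?_
  have : (Function.support fun ω => (1 - q) * shiftRatio v (a ω) y + q * shiftRatio v (b ω) y) =
      Set.univ := Set.eq_univ_of_forall fun ω => (mixture_pos hq0 hq1 _ _ y).ne'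
  simp [this]

theorem measurable_mixtureDensity (ha : Measurable a) (hb : Measurable b) :
    Measurable (mixtureDensity ρ v q a b) := by
  have h : Measurable fun z : Msg d × Ω =>
      (1 - q) * shiftRatio v (a z.2) z.1 + q * shiftRatio v (b z.2) z.1 :=
    (((measurable_shiftRatio_comp ha).comp measurable_swap).const_mul _).add
      (((measurable_shiftRatio_comp hb).comp measurable_swap).const_mul _)
  exact (h.stronglyMeasurable.integral_prod_right).measurable

theorem ofReal_mixtureDensity (hv : 0 < v) (hq0 : 0 ≤ q) (hq1 : q ≤ 1) (ha : Measurable a)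
    (haC : ∀ ω, ‖a ω‖ ≤ C) (hb : Measurable b) (hbC : ∀ ω, ‖b ω‖ ≤ C) (y : Msg d) :
    ENNReal.ofReal (mixtureDensity ρ v q a b y) =
      ∫⁻ ω, ENNReal.ofReal ((1 - q) * shiftRatio v (a ω) y + q * shiftRatio v (b ω) y) ∂ρ :=
  ofReal_integral_eq_lintegral_ofReal (integrable_mixture hv ha haC hb hbC y)
    (ae_of_all _ fun _ => (mixture_pos hq0 hq1 _ _ y).le)

/-- The common component cancels; the remaining factor `q` is the source of the amplification by
subsampling. -/
theorem abs_mixtureDensity_sub_le (hv : 0 < v) (hq0 : 0 ≤ q) (ha : Measurable a)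
    (haC : ∀ ω, ‖a ω‖ ≤ C) (hb : Measurable b) (hbC : ∀ ω, ‖b ω‖ ≤ C) (hb' : Measurable b')
    (hbC' : ∀ ω, ‖b' ω‖ ≤ C) (y : Msg d) :
    ENNReal.ofReal |mixtureDensity ρ v q a b y - mixtureDensity ρ v q a b' y| ≤
      ENNReal.ofReal q *
        ∫⁻ ω, ENNReal.ofReal |shiftRatio v (b ω) y - shiftRatio v (b' ω) y| ∂ρ := by
  have h : mixtureDensity ρ v q a b y - mixtureDensity ρ v q a b' y =
      q * ∫ ω, (shiftRatio v (b ω) y - shiftRatio v (b' ω) y) ∂ρ := by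
    rw [mixtureDensity, mixtureDensity, ← integral_sub (integrable_mixture hv ha haC hb hbC y)
      (integrable_mixture hv ha haC hb' hbC' y), ← integral_const_mul]
    congr with ω
    ring
  rw [h, abs_mul, abs_of_nonneg hq0, ENNReal.ofReal_mul hq0]
  gcongr
  rw [← ofReal_integral_eq_lintegral_ofReal]
  · exact ENNReal.ofReal_le_ofReal (abs_integral_le_integral_abs)
  · exact ((integrable_shiftRatio_left hv hb hbC y).sub
      (integrable_shiftRatio_left hv hb' hbC' y)).abs
  · exact ae_of_all _ fun _ => abs_nonneg _

/-- Convexity of `w ↦ w^(-n)` replaces the mixture in the denominator by single Gaussians, for which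
the moments are already bounded. -/
theorem lintegral_abs_sub_pow_div_mixture_le (hq0 : 0 ≤ q) (hq1 : q ≤ 1) {a b b' : Msg d} {n : ℕ}
    {K : ℝ}
    (ha : ∫⁻ y, ENNReal.ofReal (|shiftRatio v b y - shiftRatio v b' y| ^ (n + 1) /
      shiftRatio v a y ^ n) ∂(noise d v) ≤ ENNReal.ofReal K)
    (hb : ∫⁻ y, ENNReal.ofReal (|shiftRatio v b y - shiftRatio v b' y| ^ (n + 1) /
      shiftRatio v b' y ^ n) ∂(noise d v) ≤ ENNReal.ofReal K) :
    ∫⁻ y, ENNReal.ofReal (|shiftRatio v b y - shiftRatio v b' y| ^ (n + 1) /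
      ((1 - q) * shiftRatio v a y + q * shiftRatio v b' y) ^ n) ∂(noise d v) ≤
        ENNReal.ofReal K := by
  have hm : ∀ c : Msg d, Measurable fun y => ENNReal.ofReal
      (|shiftRatio v b y - shiftRatio v b' y| ^ (n + 1) / shiftRatio v c y ^ n) := fun c => by
    have h1 := measurable_shiftRatio_right (v := v) b
    have h2 := measurable_shiftRatio_right (v := v) b'
    have h3 := measurable_shiftRatio_right (v := v) c
    exact ((measurable_norm.comp (h1.sub h2)).pow_const _ |>.div (h3.pow_const _)).ennreal_ofReal
  calc _ ≤ ∫⁻ y, (ENNReal.ofReal (1 - q) * ENNReal.ofReal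
          (|shiftRatio v b y - shiftRatio v b' y| ^ (n + 1) / shiftRatio v a y ^ n) +
        ENNReal.ofReal q * ENNReal.ofReal
          (|shiftRatio v b y - shiftRatio v b' y| ^ (n + 1) / shiftRatio v b' y ^ n))
          ∂(noise d v) := by
        refine lintegral_mono fun y => ?_
        have hpa := shiftRatio_pos (v := v) a y
        have hpb := shiftRatio_pos (v := v) b' y
        rw [← ENNReal.ofReal_mul (sub_nonneg.2 hq1), ← ENNReal.ofReal_mul hq0,
          ← ENNReal.ofReal_add (mul_nonneg (sub_nonneg.2 hq1) (by positivity))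
            (mul_nonneg hq0 (by positivity))]
        refine ENNReal.ofReal_le_ofReal ?_
        rw [div_eq_mul_inv]
        refine (mul_le_mul_of_nonneg_left (inv_pow_mixture_le hq0 hq1 hpa hpb n)
          (by positivity)).trans (le_of_eq ?_)
        ring
    _ ≤ ENNReal.ofReal (1 - q) * ENNReal.ofReal K + ENNReal.ofReal q * ENNReal.ofReal K := by
        rw [lintegral_add_left ((hm a).const_mul _), lintegral_const_mul _ (hm a),
          lintegral_const_mul _ (hm b')]
        gcongr
    _ = ENNReal.ofReal K := by
        rw [← add_mul, ← ENNReal.ofReal_add (sub_nonneg.2 hq1) hq0]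
        simp

/-- Moments of the relative deviation of two mixtures that differ in a component of weight `q`. -/
theorem lintegral_relative_deviation_le (hv : 0 < v) (hq0 : 0 ≤ q) (hq1 : q ≤ 1)
    (ha : Measurable a) (haC : ∀ ω, ‖a ω‖ ≤ C) (hb : Measurable b) (hbC : ∀ ω, ‖b ω‖ ≤ C)
    (hb' : Measurable b') (hbC' : ∀ ω, ‖b' ω‖ ≤ C) {n : ℕ} {K : ℝ}
    (hK : ∀ ω, ∫⁻ y, ENNReal.ofReal (|shiftRatio v (b ω) y - shiftRatio v (b' ω) y| ^ (n + 1) /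
      ((1 - q) * shiftRatio v (a ω) y + q * shiftRatio v (b' ω) y) ^ n) ∂(noise d v) ≤
        ENNReal.ofReal K) :
    ∫⁻ y, ENNReal.ofReal (mixtureDensity ρ v q a b' y) * ENNReal.ofReal
      (|(mixtureDensity ρ v q a b y - mixtureDensity ρ v q a b' y) /
        mixtureDensity ρ v q a b' y| ^ (n + 1)) ∂(noise d v) ≤
      ENNReal.ofReal (q ^ (n + 1) * K) := by
  set F : Ω × Msg d → ℝ≥0∞ := fun z =>
    ENNReal.ofReal (|shiftRatio v (b z.1) z.2 - shiftRatio v (b' z.1) z.2| ^ (n + 1) /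
      ((1 - q) * shiftRatio v (a z.1) z.2 + q * shiftRatio v (b' z.1) z.2) ^ n) with hF
  have ma := measurable_shiftRatio_comp (v := v) ha
  have mb := measurable_shiftRatio_comp (v := v) hb
  have mb' := measurable_shiftRatio_comp (v := v) hb'
  have hFm : Measurable F :=
    ((measurable_norm.comp (mb.sub mb')).pow_const _ |>.div
      (((ma.const_mul _).add (mb'.const_mul _)).pow_const _)).ennreal_ofReal
  have hpt : ∀ y, ENNReal.ofReal (mixtureDensity ρ v q a b' y) * ENNReal.ofReal
      (|(mixtureDensity ρ v q a b y - mixtureDensity ρ v q a b' y) /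
        mixtureDensity ρ v q a b' y| ^ (n + 1)) ≤
      ENNReal.ofReal q ^ (n + 1) * ∫⁻ ω, F (ω, y) ∂ρ := fun y => by
    set hQ := mixtureDensity ρ v q a b' y with hhQ
    have hQ0 : 0 < hQ := mixtureDensity_pos hv hq0 hq1 ha haC hb' hbC' y
    have h1 := abs_mixtureDensity_sub_le (ρ := ρ) hv hq0 ha haC hb hbC hb' hbC' y
    -- For fixed `y`, joint convexity moves the power and the quotient inside the average over the
    -- centres; Tonelli then reduces to fixed centres.
    have h2 := lintegral_pow_succ_le (ρ := ρ)
      (u := fun ω => ENNReal.ofReal |shiftRatio v (b ω) y - shiftRatio v (b' ω) y|)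
      (w := fun ω => ENNReal.ofReal
        ((1 - q) * shiftRatio v (a ω) y + q * shiftRatio v (b' ω) y))
      ((measurable_norm.comp ((measurable_shiftRatio_left hb y).sub
        (measurable_shiftRatio_left hb' y))).ennreal_ofReal)
      (((measurable_shiftRatio_left ha y).const_mul _).add
        ((measurable_shiftRatio_left hb' y).const_mul _)).ennreal_ofReal
      (fun ω => (ENNReal.ofReal_pos.2 (mixture_pos hq0 hq1 _ _ y)).ne')
      (fun ω => ENNReal.ofReal_ne_top) n
    rw [← ofReal_mixtureDensity hv hq0 hq1 ha haC hb' hbC', ← hhQ] at h2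
    have hFe : ∀ ω, ENNReal.ofReal |shiftRatio v (b ω) y - shiftRatio v (b' ω) y| ^ (n + 1) /
        ENNReal.ofReal ((1 - q) * shiftRatio v (a ω) y + q * shiftRatio v (b' ω) y) ^ n =
        F (ω, y) := fun ω => by
      have hp := mixture_pos (v := v) hq0 hq1 (a ω) (b' ω) y
      simp only [hF]
      rw [ENNReal.ofReal_div_of_pos (pow_pos hp n), ENNReal.ofReal_pow (abs_nonneg _),
        ENNReal.ofReal_pow hp.le]
    simp_rw [hFe] at h2
    have h3 : ENNReal.ofReal hQ * ENNReal.ofReal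
        (|(mixtureDensity ρ v q a b y - hQ) / hQ| ^ (n + 1)) =
        ENNReal.ofReal |mixtureDensity ρ v q a b y - hQ| ^ (n + 1) / ENNReal.ofReal hQ ^ n := by
      rw [← ENNReal.ofReal_pow (abs_nonneg _), ← ENNReal.ofReal_pow hQ0.le,
        ← ENNReal.ofReal_div_of_pos (pow_pos hQ0 n), ← ENNReal.ofReal_mul hQ0.le, abs_div,
        abs_of_pos hQ0]
      congr 1
      rw [div_pow, pow_succ hQ]
      field_simp
    rw [h3]
    refine ENNReal.div_le_of_le_mul ?_
    calc _ ≤ (ENNReal.ofReal q * ∫⁻ ω, ENNReal.ofReal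
          |shiftRatio v (b ω) y - shiftRatio v (b' ω) y| ∂ρ) ^ (n + 1) :=
          pow_le_pow_left₀ zero_le h1 _
      _ ≤ _ := by
          rw [mul_pow, mul_assoc]
          gcongr
  calc _ ≤ ∫⁻ y, ENNReal.ofReal q ^ (n + 1) * ∫⁻ ω, F (ω, y) ∂ρ ∂(noise d v) :=
        lintegral_mono hpt
    _ = ENNReal.ofReal q ^ (n + 1) * ∫⁻ ω, ∫⁻ y, F (ω, y) ∂(noise d v) ∂ρ := by
        rw [lintegral_const_mul _ hFm.lintegral_prod_left',
          lintegral_lintegral_swap (f := fun ω y => F (ω, y)) hFm.aemeasurable]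
    _ ≤ ENNReal.ofReal q ^ (n + 1) * ENNReal.ofReal K := by
        gcongr
        refine (lintegral_mono hK).trans ?_
        simp
    _ = _ := by rw [← ENNReal.ofReal_pow hq0, ENNReal.ofReal_mul (pow_nonneg hq0 _)]

/-- Rényi divergence bound for Gaussian mixtures that differ in a component of small weight. -/
theorem exists_density_rpow_le (hv : 0 < v) (hC : 0 < C) (hq0 : 0 ≤ q) (hq1 : q ≤ 1)
    (ha : Measurable a) (haC : ∀ ω, ‖a ω‖ ≤ C) (hb : Measurable b) (hbC : ∀ ω, ‖b ω‖ ≤ C)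
    (hb' : Measurable b') (hbC' : ∀ ω, ‖b' ω‖ ≤ C) {P Q : Measure (Msg d)}
    [IsProbabilityMeasure P] [IsProbabilityMeasure Q]
    (hP : P = (noise d v).withDensity fun y => ENNReal.ofReal (mixtureDensity ρ v q a b y))
    (hQ : Q = (noise d v).withDensity fun y => ENNReal.ofReal (mixtureDensity ρ v q a b' y))
    {γ t α : ℝ} (hγ : 0 < γ) (hqγ : q ≤ γ) (ht : t = 4 * C ^ 2 / v) (ht1 : t ≤ 10 / 7)
    (hα : 1 < α) (hc : γ * α * (1 + 1 / t) ≤ Real.exp (-(3 * (α - 1) * t / 2))) :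
    ∃ l : Msg d → ℝ≥0∞, Measurable l ∧ P = Q.withDensity l ∧
      ∫⁻ y, l y ^ α ∂Q ≤ ENNReal.ofReal (Real.exp (3.5 * α * (α - 1) * γ ^ 2 * t)) := by
  set hp := mixtureDensity ρ v q a b with hhp
  set hq := mixtureDensity ρ v q a b' with hhq
  have hp0 : ∀ y, 0 < hp y := mixtureDensity_pos hv hq0 hq1 ha haC hb hbC
  have hq0' : ∀ y, 0 < hq y := mixtureDensity_pos hv hq0 hq1 ha haC hb' hbC'
  have hpm : Measurable hp := measurable_mixtureDensity ha hb
  have hqm : Measurable hq := measurable_mixtureDensity ha hb'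
  have ht0 : 0 < t := by rw [ht]; positivity
  set x : Msg d → ℝ := fun y => (hp y - hq y) / hq y with hx
  have hxm : Measurable x := (hpm.sub hqm).div hqm
  have h1x : ∀ y, 1 + x y = hp y / hq y := fun y => by
    have := (hq0' y).ne'
    rw [hx]
    field_simp
    ring
  have hPQ : P = Q.withDensity fun y => ENNReal.ofReal (1 + x y) := by
    rw [hP, hQ, ← withDensity_mul _ hqm.ennreal_ofReal (by fun_prop)]
    congr with y
    rw [Pi.mul_apply, h1x, ← ENNReal.ofReal_mul (hq0' y).le, mul_div_cancel₀ _ (hq0' y).ne']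
  have hdist : ∀ c c' : Msg d, ‖c‖ ≤ C → ‖c'‖ ≤ C → ‖c - c'‖ ^ 2 ≤ t * v := fun c c' h h' => by
    have h2 : ‖c - c'‖ ≤ 2 * C := (norm_sub_le _ _).trans (by linarith)
    rw [ht, div_mul_cancel₀ _ hv.ne']
    nlinarith [norm_nonneg (c - c')]
  refine ⟨_, (by fun_prop : Measurable fun y => ENNReal.ofReal (1 + x y)), hPQ, ?_⟩
  have hx1 : ∀ y, 0 < 1 + x y := fun y => by rw [h1x]; exact div_pos (hp0 y) (hq0' y)
  have hrw : ∀ y, ENNReal.ofReal (1 + x y) ^ α = ENNReal.ofReal ((1 + x y) ^ α) := fun y =>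
    ENNReal.ofReal_rpow_of_pos (hx1 y)
  simp_rw [hrw]
  refine lintegral_one_add_rpow_le hxm (fun y => by linarith [hx1 y]) ?_ hγ ht0 ht1 hα hc
    fun n => ?_
  · rw [← setLIntegral_univ, ← withDensity_apply _ MeasurableSet.univ, ← hPQ, measure_univ]
  · have hmoment : ∀ K : ℝ, 0 ≤ K → (∀ ω, ∀ c : Msg d, ‖c‖ ≤ C →
        ∫⁻ y, ENNReal.ofReal (|shiftRatio v (b ω) y - shiftRatio v (b' ω) y| ^ (n + 1 + 1) /
          shiftRatio v c y ^ (n + 1)) ∂(noise d v) ≤ ENNReal.ofReal K) →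
        ∫⁻ y, ENNReal.ofReal (|x y| ^ (n + 2)) ∂Q ≤ ENNReal.ofReal (γ ^ (n + 2) * K) :=
      fun K hK0 hK => by
      rw [hQ, lintegral_withDensity_eq_lintegral_mul _ hqm.ennreal_ofReal (by fun_prop)]
      refine (lintegral_relative_deviation_le hv hq0 hq1 ha haC hb hbC hb' hbC' fun ω =>
        lintegral_abs_sub_pow_div_mixture_le hq0 hq1 (hK ω _ (haC ω))
          (hK ω _ (hbC' ω))).trans ?_
      exact ENNReal.ofReal_le_ofReal
        (mul_le_mul_of_nonneg_right (pow_le_pow_left₀ hq0 hqγ _) hK0)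
    rcases n with _ | n
    · exact hmoment _ (by positivity) fun ω c h => lintegral_sub_sq_div_le hv ht1
        (hdist _ _ (hbC ω) h) (hdist _ _ (hbC' ω) h) (hdist _ _ (hbC ω) (hbC' ω))
    · refine (hmoment _ (by positivity) fun ω c h => lintegral_abs_sub_pow_div_le hv
        (hdist _ _ (hbC ω) h) (hdist _ _ (hbC' ω) h) (n + 1 + 1)).trans (le_of_eq ?_)
      simp only [momentBound]
      push_cast
      congr 6
      ring

end GaussianMixture

/-! ### From moments of a density to approximate domination, and products. -/

section Density

variable {Y : Type*} [MeasurableSpace Y]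

/-- Conversion of a bound on the `α`-th moment of the density into approximate domination. -/
theorem withDensity_apply_le_exp_mul_add {Q : Measure Y} {l : Y → ℝ≥0∞} (hl : Measurable l)
    {α ε η : ℝ} (hα : 1 < α)
    (hmom : ∫⁻ y, l y ^ α ∂Q ≤ ENNReal.ofReal (Real.exp ((α - 1) * η)))
    {S : Set Y} (hS : MeasurableSet S) :
    Q.withDensity l S ≤ ENNReal.ofReal (Real.exp ε) * Q S +
      ENNReal.ofReal (Real.exp (-((α - 1) * (ε - η)))) := by
  -- Where `l` exceeds `e^ε`, the factor `(l / e^ε)^(α-1)` is at least one, so `l` is at most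
  -- `e^(-(α-1)ε) l^α`.
  have hpt : ∀ y, l y ≤ ENNReal.ofReal (Real.exp ε) +
      ENNReal.ofReal (Real.exp (-((α - 1) * ε))) * l y ^ α := fun y => by
    rcases le_total (l y) (ENNReal.ofReal (Real.exp ε)) with h | h
    · exact h.trans (le_add_of_nonneg_right zero_le)
    · refine le_trans ?_ (le_add_of_nonneg_left zero_le)
      have h0 : l y ≠ 0 := ((ENNReal.ofReal_pos.2 (Real.exp_pos ε)).trans_le h).ne'
      rcases eq_or_ne (l y) ∞ with ht | ht
      · rw [ht, ENNReal.top_rpow_of_pos (by linarith), ENNReal.mul_top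
          (ENNReal.ofReal_pos.2 (Real.exp_pos _)).ne']
      have h1 : l y ^ α = l y ^ (α - 1) * l y := by
        conv_rhs => rw [← ENNReal.rpow_one (l y), ← ENNReal.rpow_mul, one_mul]
        rw [← ENNReal.rpow_add _ _ h0 ht]
        congr 1
        ring
      have h2 : ENNReal.ofReal (Real.exp ((α - 1) * ε)) ≤ l y ^ (α - 1) := by
        rw [mul_comm, Real.exp_mul, ← ENNReal.ofReal_rpow_of_pos (Real.exp_pos _)]
        exact ENNReal.rpow_le_rpow h (by linarith)
      calc l y = ENNReal.ofReal (Real.exp (-((α - 1) * ε))) *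
            (ENNReal.ofReal (Real.exp ((α - 1) * ε)) * l y) := by
            rw [← mul_assoc, ← ENNReal.ofReal_mul (Real.exp_pos _).le, ← Real.exp_add]
            simp
        _ ≤ _ := by
            rw [h1]
            gcongr
  calc Q.withDensity l S = ∫⁻ y in S, l y ∂Q := withDensity_apply _ hS
    _ ≤ ∫⁻ y in S, (ENNReal.ofReal (Real.exp ε) +
        ENNReal.ofReal (Real.exp (-((α - 1) * ε))) * l y ^ α) ∂Q := lintegral_mono hpt
    _ = ENNReal.ofReal (Real.exp ε) * Q S +
        ENNReal.ofReal (Real.exp (-((α - 1) * ε))) * ∫⁻ y in S, l y ^ α ∂Q := by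
        rw [lintegral_add_left measurable_const, lintegral_const_mul _ (by fun_prop),
          setLIntegral_const]
    _ ≤ ENNReal.ofReal (Real.exp ε) * Q S +
        ENNReal.ofReal (Real.exp (-((α - 1) * ε))) *
          ENNReal.ofReal (Real.exp ((α - 1) * η)) := by
        gcongr
        exact (setLIntegral_le_lintegral _ _).trans hmom
    _ = _ := by
        rw [← ENNReal.ofReal_mul (Real.exp_pos _).le, ← Real.exp_add]
        congr 3
        ring

variable {ι : Type*} [Fintype ι]

theorem lintegral_pi_prod_eq_prod {Q : Measure Y} [IsProbabilityMeasure Q] {g : ι → Y → ℝ≥0∞}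
    (hg : ∀ i, Measurable (g i)) :
    ∫⁻ x, ∏ i, g i (x i) ∂(Measure.pi fun _ : ι => Q) = ∏ i, ∫⁻ y, g i y ∂Q := by
  have h := lintegral_prod_eq_prod_lintegral_of_indepFun (μ := Measure.pi fun _ : ι => Q)
    Finset.univ (fun i x => g i (x i))
    (iIndepFun_pi (X := g) fun i => (hg i).aemeasurable)
    (fun i => (hg i).comp (measurable_pi_apply i))
  rw [h]
  exact Finset.prod_congr rfl fun i _ =>
    (measurePreserving_eval (fun _ : ι => Q) i).lintegral_comp (hg i)

theorem pi_withDensity {Q : Measure Y} [IsProbabilityMeasure Q] {l : Y → ℝ≥0∞}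
    (hl : Measurable l) [IsProbabilityMeasure (Q.withDensity l)] :
    (Measure.pi fun _ : ι => Q.withDensity l) =
      (Measure.pi fun _ : ι => Q).withDensity fun x => ∏ i, l (x i) := by
  refine Measure.pi_eq fun s hs => ?_
  rw [withDensity_apply _ (MeasurableSet.univ_pi hs),
    ← lintegral_indicator (MeasurableSet.univ_pi hs)]
  have h : ∀ x : ι → Y, (Set.univ.pi s).indicator (fun x => ∏ i, l (x i)) x =
      ∏ i, (s i).indicator l (x i) := fun x => by
    by_cases hx : x ∈ Set.univ.pi s
    · rw [Set.indicator_of_mem hx]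
      exact Finset.prod_congr rfl fun i _ =>
        (Set.indicator_of_mem (hx i (Set.mem_univ i)) _).symm
    · rw [Set.indicator_of_notMem hx]
      obtain ⟨i, hi⟩ : ∃ i, x i ∉ s i := by simpa [Set.mem_pi] using hx
      exact (Finset.prod_eq_zero (Finset.mem_univ i) (Set.indicator_of_notMem hi _)).symm
  simp_rw [h]
  rw [lintegral_pi_prod_eq_prod fun i => hl.indicator (hs i)]
  exact Finset.prod_congr rfl fun i _ => by
    rw [lintegral_indicator (hs i), withDensity_apply _ (hs i)]

theorem lintegral_pi_prod_rpow {Q : Measure Y} [IsProbabilityMeasure Q] {l : Y → ℝ≥0∞}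
    (hl : Measurable l) {α : ℝ} (hα : 0 ≤ α) :
    ∫⁻ x, (∏ i, l (x i)) ^ α ∂(Measure.pi fun _ : ι => Q) =
      (∫⁻ y, l y ^ α ∂Q) ^ Fintype.card ι := by
  simp_rw [← ENNReal.prod_rpow_of_nonneg hα]
  rw [lintegral_pi_prod_eq_prod (g := fun _ y => l y ^ α) fun _ => hl.pow_const α]
  simp

/-- The density of the product is the product of densities, so its `α`-th moments multiply and the
costs `κ` add up. -/
theorem pi_apply_le_exp_mul_add {P Q : Measure Y} [IsProbabilityMeasure P]
    [IsProbabilityMeasure Q] {l : Y → ℝ≥0∞} (hl : Measurable l) (hPQ : P = Q.withDensity l)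
    {α ε η κ : ℝ} (hα : 1 < α)
    (hmom : ∫⁻ y, l y ^ α ∂Q ≤ ENNReal.ofReal (Real.exp ((α - 1) * κ)))
    (hκ : Fintype.card ι * κ ≤ η) {S : Set (ι → Y)} (hS : MeasurableSet S) :
    (Measure.pi fun _ : ι => P) S ≤
      ENNReal.ofReal (Real.exp ε) * (Measure.pi fun _ : ι => Q) S +
        ENNReal.ofReal (Real.exp (-((α - 1) * (ε - η)))) := by
  have : IsProbabilityMeasure (Q.withDensity l) := hPQ ▸ inferInstance
  subst hPQ
  rw [pi_withDensity hl]
  have hm : Measurable fun x : ι → Y => ∏ i, l (x i) :=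
    Finset.measurable_prod _ fun i _ => hl.comp (measurable_pi_apply i)
  refine withDensity_apply_le_exp_mul_add hm hα ?_ hS
  rw [lintegral_pi_prod_rpow hl (by linarith)]
  refine (pow_le_pow_left₀ zero_le hmom _).trans ?_
  rw [← ENNReal.ofReal_pow (Real.exp_pos _).le, ← Real.exp_nat_mul]
  refine ENNReal.ofReal_le_ofReal (Real.exp_le_exp.2 ?_)
  nlinarith

end Density

/-! ### Uniform mixtures. -/

section Mixture

variable {ι Y : Type*} [MeasurableSpace Y]

theorem uniformMixture_apply (s : Finset ι) (μ : ι → Measure Y) (S : Set Y) :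
    uniformMixture s μ S = (s.card : ℝ≥0∞)⁻¹ * ∑ j ∈ s, μ j S := by
  simp [uniformMixture]

theorem lintegral_uniformMixture (s : Finset ι) (μ : ι → Measure Y) (g : Y → ℝ≥0∞) :
    ∫⁻ y, g y ∂(uniformMixture s μ) = (s.card : ℝ≥0∞)⁻¹ * ∑ j ∈ s, ∫⁻ y, g y ∂(μ j) := by
  rw [uniformMixture, lintegral_smul_measure, lintegral_finsetSum_measure, smul_eq_mul]

theorem isProbabilityMeasure_uniformMixture {s : Finset ι} (hs : s.Nonempty) {μ : ι → Measure Y}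
    (hμ : ∀ j, IsProbabilityMeasure (μ j)) : IsProbabilityMeasure (uniformMixture s μ) := by
  refine ⟨?_⟩
  rw [uniformMixture_apply]
  simp only [measure_univ, Finset.sum_const, nsmul_eq_mul, mul_one]
  exact ENNReal.inv_mul_cancel (by simpa using hs.ne_empty) (by simp)

/-- The inequality is affine and the weights agree on both sides, so it can be averaged. The weights
need only sum to at most one, which covers an empty `s`. -/
theorem uniformMixture_apply_le {s : Finset ι} {μ ν : ι → Measure Y} {S : Set Y} {c e : ℝ≥0∞}
    (h : ∀ j ∈ s, μ j S ≤ c * ν j S + e) :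
    uniformMixture s μ S ≤ c * uniformMixture s ν S + e := by
  rw [uniformMixture_apply, uniformMixture_apply]
  calc (s.card : ℝ≥0∞)⁻¹ * ∑ j ∈ s, μ j S
      ≤ (s.card : ℝ≥0∞)⁻¹ * ∑ j ∈ s, (c * ν j S + e) := by
        gcongr with j hj
        exact h j hj
    _ = c * ((s.card : ℝ≥0∞)⁻¹ * ∑ j ∈ s, ν j S) + (s.card : ℝ≥0∞)⁻¹ * s.card * e := by
        rw [Finset.sum_add_distrib, ← Finset.mul_sum, Finset.sum_const, nsmul_eq_mul]
        ring
    _ ≤ _ := by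
        gcongr
        exact mul_le_of_le_one_left zero_le (ENNReal.inv_mul_le_one _)

theorem uniformMixture_union [DecidableEq ι] {s₀ s₁ : Finset ι} (hd : Disjoint s₀ s₁)
    (h₀ : s₀.Nonempty) (h₁ : s₁.Nonempty) (μ : ι → Measure Y) {q : ℝ}
    (hq : q = s₁.card / (s₀ ∪ s₁).card) :
    uniformMixture (s₀ ∪ s₁) μ = ENNReal.ofReal (1 - q) • uniformMixture s₀ μ +
      ENNReal.ofReal q • uniformMixture s₁ μ := by
  have c₀ : (0 : ℝ) < s₀.card := by exact_mod_cast h₀.card_pos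
  have c₁ : (0 : ℝ) < s₁.card := by exact_mod_cast h₁.card_pos
  have hc : ((s₀ ∪ s₁).card : ℝ) = s₀.card + s₁.card := by
    rw [Finset.card_union_of_disjoint hd]; push_cast; rfl
  have hinv : ∀ s : Finset ι, (0 : ℝ) < s.card →
      (s.card : ℝ≥0∞)⁻¹ = ENNReal.ofReal ((s.card : ℝ)⁻¹) := fun s h => by
    rw [ENNReal.ofReal_inv_of_pos h, ENNReal.ofReal_natCast]
  have hq1 : 1 - q = s₀.card / (s₀ ∪ s₁).card := by
    rw [hq, hc]; field_simp; ring
  simp only [uniformMixture]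
  rw [Finset.sum_union hd, smul_add, smul_smul, smul_smul, hinv _ c₀, hinv _ c₁,
    hinv _ (hc ▸ by positivity), ← ENNReal.ofReal_mul (hq1 ▸ by positivity),
    ← ENNReal.ofReal_mul (hq ▸ by positivity), hq1, hq]
  congr 3
  · field_simp
  · field_simp

end Mixture

/-! ### The law of one privatized message. -/

section Message

variable {n d : ℕ} {T : Type*} {v C : ℝ}

theorem measurable_clip : Measurable (clip C : Msg d → Msg d) := by
  unfold clip
  fun_prop

theorem norm_clip_le (hC : 0 < C) (c : Msg d) : ‖clip C c‖ ≤ C := by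
  have hm : 0 < max 1 (‖c‖ / C) := lt_max_of_lt_left one_pos
  rw [clip, norm_smul, norm_inv, Real.norm_of_nonneg hm.le, inv_mul_le_iff₀ hm]
  calc ‖c‖ = ‖c‖ / C * C := (div_mul_cancel₀ _ hC.ne').symm
    _ ≤ _ := by gcongr; exact le_max_right _ _

theorem conv_noise_apply (hv : 0 < v) (μ : Measure (Msg d)) [SFinite μ] {S : Set (Msg d)}
    (hS : MeasurableSet S) :
    ((μ.map (clip C)) ∗ noise d v) S =
      ∫⁻ c, ∫⁻ y in S, ENNReal.ofReal (shiftRatio v (clip C c) y) ∂(noise d v) ∂μ := by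
  have hm : Measurable (S.indicator (1 : Msg d → ℝ≥0∞)) := measurable_one.indicator hS
  rw [← lintegral_indicator_one hS, Measure.lintegral_conv hm, lintegral_map _ measurable_clip]
  · refine lintegral_congr fun c => ?_
    rw [← withDensity_apply _ hS, ← map_add_noise hv, ← lintegral_indicator_one hS,
      lintegral_map hm (by fun_prop)]
  · exact Measurable.lintegral_prod_right' (f := fun z : Msg d × Msg d =>
      S.indicator (1 : Msg d → ℝ≥0∞) (z.1 + z.2)) (hm.comp (by fun_prop))

/-- The law of the raw message of a random set of transitions. -/
def rawMixture (f : MessageFunction n T d) (s : Finset (Finset (Fin n))) (τ : Fin n → T) :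
    Measure (Msg d) :=
  uniformMixture s fun J => (f J fun t => τ t : Measure (Msg d))

theorem messageLaw_eq_withDensity (hv : 0 < v) (f : MessageFunction n T d) (γ : ℝ)
    (τ : Fin n → T) :
    messageLaw f γ C v τ = (noise d v).withDensity fun y => ∫⁻ c,
      ENNReal.ofReal (shiftRatio v (clip C c) y)
        ∂(rawMixture f (Finset.powersetCard ⌊γ * (n : ℝ)⌋₊ Finset.univ) τ) := by
  have hm : Measurable fun z : Msg d × Msg d =>
      ENNReal.ofReal (shiftRatio v (clip C z.1) z.2) :=
    (measurable_shiftRatio_comp measurable_clip).ennreal_ofReal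
  ext S hS
  rw [withDensity_apply _ hS, messageLaw, uniformMixture_apply]
  simp only [rawMixture, lintegral_uniformMixture]
  rw [lintegral_const_mul _ (Finset.measurable_sum _ fun J _ => hm.lintegral_prod_left'),
    lintegral_finsetSum _ fun J _ => hm.lintegral_prod_left']
  congr 1
  refine Finset.sum_congr rfl fun J _ => ?_
  rw [conv_noise_apply hv _ hS,
    lintegral_lintegral_swap (f := fun c y => ENNReal.ofReal (shiftRatio v (clip C c) y))
      hm.aemeasurable]

theorem nonempty_powersetCard_floor {γ : ℝ} (hγ1 : γ < 1) :
    (Finset.powersetCard ⌊γ * (n : ℝ)⌋₊ (Finset.univ : Finset (Fin n))).Nonempty := by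
  rw [Finset.powersetCard_nonempty, Finset.card_univ, Fintype.card_fin]
  refine Nat.floor_le_of_le ?_
  nlinarith [(Nat.cast_nonneg n : (0 : ℝ) ≤ n)]

theorem isProbabilityMeasure_messageLaw {γ : ℝ} (hγ1 : γ < 1) (f : MessageFunction n T d)
    (τ : Fin n → T) : IsProbabilityMeasure (messageLaw f γ C v τ) := by
  refine isProbabilityMeasure_uniformMixture (nonempty_powersetCard_floor hγ1) fun J => ?_
  have : IsProbabilityMeasure ((f J fun t => τ t : Measure (Msg d)).map (clip C)) :=
    Measure.isProbabilityMeasure_map measurable_clip.aemeasurable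
  infer_instance

/-- Neighbouring trajectories give laws that share a component of weight at least `1 - γ`. -/
theorem exists_rawMixture_eq {γ : ℝ} (hγ0 : 0 < γ) (hγ1 : γ < 1) (f : MessageFunction n T d)
    {τ τ' : Fin n → T} (h : Neighbours τ τ') :
    ∃ (q : ℝ) (A B B' : Measure (Msg d)), 0 ≤ q ∧ q ≤ γ ∧ IsProbabilityMeasure A ∧
      IsProbabilityMeasure B ∧ IsProbabilityMeasure B' ∧
      rawMixture f (Finset.powersetCard ⌊γ * (n : ℝ)⌋₊ Finset.univ) τ =
        ENNReal.ofReal (1 - q) • A + ENNReal.ofReal q • B ∧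
      rawMixture f (Finset.powersetCard ⌊γ * (n : ℝ)⌋₊ Finset.univ) τ' =
        ENNReal.ofReal (1 - q) • A + ENNReal.ofReal q • B' := by
  classical
  obtain ⟨r, hr⟩ := h
  obtain ⟨m, rfl⟩ : ∃ m, n = m + 1 := ⟨n - 1, by have := r.pos; omega⟩
  set k := ⌊γ * ((m + 1 : ℕ) : ℝ)⌋₊ with hk
  have hkγ : (k : ℝ) ≤ γ * (m + 1 : ℕ) := Nat.floor_le (by positivity)
  have hkm : k ≤ m := by
    have h1 : (k : ℝ) < (m + 1 : ℕ) := hkγ.trans_lt (mul_lt_of_lt_one_left (by positivity) hγ1)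
    have : k < m + 1 := by exact_mod_cast h1
    omega
  set s := Finset.powersetCard k (Finset.univ : Finset (Fin (m + 1))) with hs
  -- `s₀` collects the samples that miss the changed transition `r`. The complementary proportion is
  -- `k / (m + 1)`, at most `γ` because `k` is a floor.
  set s₀ := Finset.powersetCard k (Finset.univ.erase r) with hs₀
  set s₁ := s \ s₀ with hs₁
  have hsub : s₀ ⊆ s := Finset.powersetCard_mono (Finset.erase_subset _ _)
  have hunion : s₀ ∪ s₁ = s := Finset.union_sdiff_of_subset hsub
  have hdisj : Disjoint s₀ s₁ := Finset.disjoint_sdiff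
  have hcs : s.card = (m + 1).choose k := by simp [hs]
  have hcs₀ : s₀.card = m.choose k := by simp [hs₀]
  have hne₀ : s₀.Nonempty := by
    rw [← Finset.card_pos, hcs₀]
    exact Nat.choose_pos hkm
  have hA : ∀ J ∈ s₀, (f J fun t => τ t : Measure (Msg (d := d))) = f J fun t => τ' t := by
    intro J hJ
    have : (fun t : J => τ t) = fun t : J => τ' t := funext fun t => hr t fun he => by
      have h1 := (Finset.mem_powersetCard.1 hJ).1 t.2
      rw [he] at h1
      exact Finset.notMem_erase r _ h1
    rw [this]
  have hA' : rawMixture f s₀ τ = rawMixture f s₀ τ' := by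
    simp only [rawMixture, uniformMixture]
    rw [Finset.sum_congr rfl hA]
  have hpA : IsProbabilityMeasure (rawMixture f s₀ τ) :=
    isProbabilityMeasure_uniformMixture hne₀ fun J => inferInstance
  -- If no sample contains `r`, there is no conditional law for `B`; with `q = 0` any probability
  -- measure serves.
  rcases s₁.eq_empty_or_nonempty with he | hne₁
  · have hss : s = s₀ := by rw [← hunion, he, Finset.union_empty]
    refine ⟨0, rawMixture f s₀ τ, rawMixture f s₀ τ, rawMixture f s₀ τ, le_rfl, hγ0.le, hpA, hpA,
      hpA, ?_, ?_⟩
    · rw [hss]; simp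
    · rw [hss, ← hA']; simp
  · have hcard : (s₀.card : ℝ) + s₁.card = s.card := by
      rw [← hunion, Finset.card_union_of_disjoint hdisj]; push_cast; rfl
    have hs0 : (0 : ℝ) < s.card := by
      rw [hcs]; exact_mod_cast Nat.choose_pos (by omega)
    refine ⟨s₁.card / s.card, rawMixture f s₀ τ, rawMixture f s₁ τ, rawMixture f s₁ τ',
      by positivity, ?_, hpA, isProbabilityMeasure_uniformMixture hne₁ fun J => inferInstance,
      isProbabilityMeasure_uniformMixture hne₁ fun J => inferInstance, ?_, ?_⟩
    · have hch := Nat.choose_mul_succ_eq m k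
      rw [← hcs, ← hcs₀] at hch
      have hch' : (s₀.card : ℝ) * (m + 1) = s.card * (m + 1 - k) := by
        have := congrArg (Nat.cast (R := ℝ)) hch
        push_cast [Nat.cast_sub (show k ≤ m + 1 by omega)] at this
        exact this
      rw [div_le_iff₀ hs0]
      have hm : (0 : ℝ) < m + 1 := by positivity
      push_cast at hkγ
      refine le_of_mul_le_mul_right ?_ hm
      calc (s₁.card : ℝ) * (m + 1) = s.card * k := by
            rw [← eq_sub_iff_add_eq'] at hcard
            rw [hcard]; linarith
        _ ≤ s.card * (γ * (m + 1)) := by gcongr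
        _ = _ := by ring
    · rw [← hunion]
      exact uniformMixture_union hdisj hne₀ hne₁ _ rfl
    · rw [← hunion, hA']
      exact uniformMixture_union hdisj hne₀ hne₁ _ rfl

theorem ofReal_mixtureDensity_eq {Ω : Type*} [MeasurableSpace Ω] {ρ : Measure Ω}
    [IsProbabilityMeasure ρ] {A B : Measure (Msg d)} {g h : Ω → Msg d} {q : ℝ}
    (hg : MeasurePreserving g ρ A) (hh : MeasurePreserving h ρ B) (hv : 0 < v) (hC : 0 < C)
    (hq0 : 0 ≤ q) (hq1 : q ≤ 1) (y : Msg d) :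
    ENNReal.ofReal (mixtureDensity ρ v q (clip C ∘ g) (clip C ∘ h) y) =
      ∫⁻ c, ENNReal.ofReal (shiftRatio v (clip C c) y)
        ∂(ENNReal.ofReal (1 - q) • A + ENNReal.ofReal q • B) := by
  have hm : Measurable fun c : Msg d => ENNReal.ofReal (shiftRatio v (clip C c) y) :=
    (measurable_shiftRatio_left measurable_clip y).ennreal_ofReal
  have hmg : Measurable fun ω => ENNReal.ofReal (shiftRatio v (clip C (g ω)) y) :=
    hm.comp hg.measurable
  have hmh : Measurable fun ω => ENNReal.ofReal (shiftRatio v (clip C (h ω)) y) :=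
    hm.comp hh.measurable
  rw [ofReal_mixtureDensity hv hq0 hq1 (measurable_clip.comp hg.measurable)
    (fun ω => norm_clip_le hC _) (measurable_clip.comp hh.measurable)
    (fun ω => norm_clip_le hC _), lintegral_add_measure, lintegral_smul_measure,
    lintegral_smul_measure, ← hg.lintegral_comp hm, ← hh.lintegral_comp hm, smul_eq_mul,
    smul_eq_mul, ← lintegral_const_mul _ hmg,
    ← lintegral_const_mul _ hmh, ← lintegral_add_left (hmg.const_mul _)]
  refine lintegral_congr fun ω => ?_
  simp only [Function.comp_apply]
  rw [ENNReal.ofReal_add (mul_nonneg (sub_nonneg.2 hq1) (shiftRatio_pos _ _).le)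
    (mul_nonneg hq0 (shiftRatio_pos _ _).le), ENNReal.ofReal_mul (sub_nonneg.2 hq1),
    ENNReal.ofReal_mul hq0]

/-- Rényi differential privacy of one privatized message. -/
theorem exists_messageLaw_density_rpow_le (hv : 0 < v) (hC : 0 < C) {γ t α : ℝ} (hγ0 : 0 < γ)
    (hγ1 : γ < 1) (f : MessageFunction n T d) {τ τ' : Fin n → T} (h : Neighbours τ τ')
    (ht : t = 4 * C ^ 2 / v) (ht1 : t ≤ 10 / 7) (hα : 1 < α)
    (hc : γ * α * (1 + 1 / t) ≤ Real.exp (-(3 * (α - 1) * t / 2))) :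
    ∃ l : Msg d → ℝ≥0∞, Measurable l ∧
      messageLaw f γ C v τ = (messageLaw f γ C v τ').withDensity l ∧
      ∫⁻ y, l y ^ α ∂(messageLaw f γ C v τ') ≤
        ENNReal.ofReal (Real.exp (3.5 * α * (α - 1) * γ ^ 2 * t)) := by
  obtain ⟨q, A, B, B', hq0, hqγ, hA, hB, hB', hR, hR'⟩ := exists_rawMixture_eq hγ0 hγ1 f h
  have hP := isProbabilityMeasure_messageLaw (C := C) (v := v) hγ1 f τ
  have hQ := isProbabilityMeasure_messageLaw (C := C) (v := v) hγ1 f τ'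
  have hq1 : q ≤ 1 := hqγ.trans hγ1.le
  -- Both mixtures are realized on one probability space with the same `A`-coordinate, so their
  -- common part cancels pointwise. Only the marginals matter; independence is the simplest
  -- coupling.
  have m1 : MeasurePreserving Prod.fst (A.prod (B.prod B')) A := measurePreserving_fst
  have m2 : MeasurePreserving (fun z => z.2.1) (A.prod (B.prod B')) B :=
    measurePreserving_fst.comp measurePreserving_snd
  have m3 : MeasurePreserving (fun z => z.2.2) (A.prod (B.prod B')) B' :=
    measurePreserving_snd.comp measurePreserving_snd
  refine exists_density_rpow_le (ρ := A.prod (B.prod B')) hv hC hq0 hq1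
    (measurable_clip.comp m1.measurable) (fun ω => norm_clip_le hC _)
    (measurable_clip.comp m2.measurable) (fun ω => norm_clip_le hC _)
    (measurable_clip.comp m3.measurable) (fun ω => norm_clip_le hC _) ?_ ?_ hγ0 hqγ ht ht1 hα hc
  · rw [messageLaw_eq_withDensity hv, hR]
    congr with y
    exact (ofReal_mixtureDensity_eq m1 m2 hv hC hq0 hq1 y).symm
  · rw [messageLaw_eq_withDensity hv, hR']
    congr with y
    exact (ofReal_mixtureDensity_eq m1 m3 hv hC hq0 hq1 y).symm

end Message

/-! ### The communication step. -/

section Communication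

variable {N n d : ℕ} {T : Type*} {i : Fin N} {f : MessageFunction n T d} {γ₁ γ₂ C v : ℝ}

theorem measurable_transcript_mk (K : Finset (Fin N)) :
    Measurable fun m : K → Msg d => (⟨K, m⟩ : Transcript N d) := fun _ hS =>
  MeasurableSpace.measurableSet_iInf.1 hS K

theorem measurable_transcript_mk_const (K : Finset (Fin N)) :
    Measurable fun m : Msg d => (⟨K, fun _ => m⟩ : Transcript N d) :=
  (measurable_transcript_mk K).comp (measurable_pi_lambda _ fun _ => measurable_id)

theorem isDP_compositeCommunication {ε δ : ℝ}
    (h : ∀ τ τ' : Fin n → T, Neighbours τ τ' → ∀ K ∈ targetSets i γ₂,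
      ∀ S : Set (K → Msg d), MeasurableSet S →
        (Measure.pi fun _ : K => messageLaw f γ₁ C v τ) S ≤ ENNReal.ofReal (Real.exp ε) *
          (Measure.pi fun _ : K => messageLaw f γ₁ C v τ') S + ENNReal.ofReal δ) :
    IsDP Neighbours (compositeCommunication i f γ₁ γ₂ C v) ε δ := by
  intro τ τ' hτ S hS
  refine uniformMixture_apply_le fun K hK => ?_
  rw [Measure.map_apply (measurable_transcript_mk K) hS,
    Measure.map_apply (measurable_transcript_mk K) hS]
  exact h τ τ' hτ K hK _ (measurable_transcript_mk K hS)

theorem isDP_sharedCommunication {ε δ : ℝ} (hε : 0 ≤ ε) (hγ₁ : γ₁ < 1)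
    (h : 1 ≤ γ₂ * N → ∀ τ τ' : Fin n → T, Neighbours τ τ' →
      ∀ S : Set (Msg d), MeasurableSet S → messageLaw f γ₁ C v τ S ≤
        ENNReal.ofReal (Real.exp ε) * messageLaw f γ₁ C v τ' S + ENNReal.ofReal δ) :
    IsDP Neighbours (sharedCommunication i f γ₁ γ₂ C v) ε δ := by
  intro τ τ' hτ S hS
  refine uniformMixture_apply_le fun K hK => ?_
  rw [Measure.map_apply (measurable_transcript_mk_const K) hS,
    Measure.map_apply (measurable_transcript_mk_const K) hS]
  -- When `γ₂N < 1` the budget `γ₂Nκ` does not cover one message, but then nobody receives it and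
  -- the transcript for `K = ∅` is constant.
  rcases lt_or_ge (γ₂ * N) 1 with hN | hN
  · have hK0 : K = ∅ := by
      rw [← Finset.card_eq_zero, (Finset.mem_powersetCard.1 hK).2]
      exact Nat.floor_eq_zero.2 hN
    have := isProbabilityMeasure_messageLaw (C := C) (v := v) hγ₁ f τ
    have := isProbabilityMeasure_messageLaw (C := C) (v := v) hγ₁ f τ'
    subst hK0
    have hconst : ∀ m m' : Msg d, (⟨∅, fun _ => m⟩ : Transcript N d) = ⟨∅, fun _ => m'⟩ :=
      fun m m' => by
      congr 1
      exact funext fun x => absurd x.2 (Finset.notMem_empty _)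
    have hpre : (fun m : Msg d => (⟨∅, fun _ => m⟩ : Transcript N d)) ⁻¹' S = ∅ ∨
        (fun m : Msg d => (⟨∅, fun _ => m⟩ : Transcript N d)) ⁻¹' S = Set.univ := by
      by_cases h0 : (⟨∅, fun _ => 0⟩ : Transcript N d) ∈ S
      · exact Or.inr (Set.eq_univ_of_forall fun m => by
          rw [Set.mem_preimage, hconst m 0]; exact h0)
      · exact Or.inl (Set.eq_empty_of_forall_notMem fun m => by
          rw [Set.mem_preimage, hconst m 0]; exact h0)
    rcases hpre with hp | hp
    · simp [hp]
    · rw [hp, measure_univ, measure_univ, mul_one]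
      refine le_trans ?_ (le_add_of_nonneg_right zero_le)
      rw [← ENNReal.ofReal_one]
      exact ENNReal.ofReal_le_ofReal (Real.one_le_exp hε)
  · exact h hN τ τ' hτ _ (measurable_transcript_mk_const K hS)

end Communication

end DPMAC

end

/-! ### Calibration of the parameters. -/

theorem theorem1 {N n d : ℕ} {T : Type*} (i : Fin N) (f : DPMAC.MessageFunction n T d)
    (γ₁ γ₂ C β ε δ α v s : ℝ)
    (hγ₁ : γ₁ ∈ Set.Ioo (0 : ℝ) 1) (hγ₂ : γ₂ ∈ Set.Ioo (0 : ℝ) 1) (hC : 0 < C)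
    (hβ : β ∈ Set.Ioo (0 : ℝ) 1) (hε : 0 < ε) (hδ : 0 < δ)
    (hα : α = Real.log (1 / δ) / (ε * (1 - β)) + 1)
    (hv : v = 14 * γ₂ * γ₁ ^ 2 * (N : ℝ) * C ^ 2 * α / (β * ε))
    (hs : s = v / (4 * C ^ 2))
    (hs_ge : 0.7 ≤ s)
    (hα_le : α ≤ 2 * s * Real.log (1 / (γ₁ * α * (1 + s))) / 3 + 1) :
    DPMAC.IsDP DPMAC.Neighbours (DPMAC.compositeCommunication i f γ₁ γ₂ C v) ε δ ∧
    DPMAC.IsDP DPMAC.Neighbours (DPMAC.sharedCommunication i f γ₁ γ₂ C v) ε δ := by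
  obtain ⟨hγ0, hγ1⟩ := hγ₁
  obtain ⟨hγ0', hγ1'⟩ := hγ₂
  obtain ⟨hβ0, hβ1⟩ := hβ
  have hprob := DPMAC.isProbabilityMeasure_messageLaw (C := C) (v := v) hγ1 f
  -- For `δ ≥ 1` the claim is trivial, and `α > 1` would fail.
  rcases le_or_gt 1 δ with hδ1 | hδ1
  · have hbound : ∀ x y : ENNReal, x ≤ 1 → x ≤ y + ENNReal.ofReal δ := fun x y hx =>
      (hx.trans (ENNReal.one_le_ofReal.2 hδ1)).trans (le_add_of_nonneg_left zero_le)
    exact ⟨DPMAC.isDP_compositeCommunication fun τ τ' _ K _ S _ => hbound _ _ prob_le_one,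
      DPMAC.isDP_sharedCommunication hε.le hγ1 fun _ τ τ' _ S _ => hbound _ _ prob_le_one⟩
  have hs0 : 0 < s := by linarith
  have hv0 : 0 < v := by
    have := mul_pos hs0 (show 0 < 4 * C ^ 2 by positivity)
    rwa [hs, div_mul_cancel₀ _ (by positivity)] at this
  have hβ' : 0 < 1 - β := by linarith
  have hlog : 0 < Real.log (1 / δ) := Real.log_pos (by rwa [lt_div_iff₀ hδ, one_mul])
  have hα1 : 1 < α := by
    rw [hα]
    have : 0 < Real.log (1 / δ) / (ε * (1 - β)) := by positivity
    linarith
  have hN : (0 : ℝ) < N := by exact_mod_cast i.pos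
  set t : ℝ := 4 * C ^ 2 / v with ht
  have ht0 : 0 < t := by positivity
  have hst : s = 1 / t := by rw [hs, ht, one_div_div]
  have ht1 : t ≤ 10 / 7 := by
    rw [hst, le_div_iff₀ ht0] at hs_ge
    linarith
  -- This is the assumed upper bound on `α`, exponentiated, with `s = 1/t`.
  have hc : γ₁ * α * (1 + 1 / t) ≤ Real.exp (-(3 * (α - 1) * t / 2)) := by
    rw [← hst]
    have hpos : 0 < γ₁ * α * (1 + s) := by positivity
    rw [← Real.log_le_iff_le_exp hpos]
    rw [one_div, Real.log_inv] at hα_le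
    have hts : t * s = 1 := by rw [hst]; field_simp
    have h1 : (α - 1) * t ≤ 2 * (t * s) * -Real.log (γ₁ * α * (1 + s)) / 3 := by
      refine (mul_le_mul_of_nonneg_right (sub_le_iff_le_add.2 hα_le) ht0.le).trans
        (le_of_eq ?_)
      ring
    rw [hts] at h1
    linarith
  set κ : ℝ := 3.5 * α * γ₁ ^ 2 * t with hκ
  have hκ0 : 0 < κ := by positivity
  -- The factor 14 in the variance is `3.5 · 4`, from the second moment constant and `t = 4C²/v`.
  have hcomp : γ₂ * N * κ = β * ε := by
    have h1 : v * (β * ε) = 14 * γ₂ * γ₁ ^ 2 * (N : ℝ) * C ^ 2 * α := by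
      conv_lhs => rw [hv]
      field_simp
    rw [hκ, ht]
    field_simp
    linarith
  -- The remaining budget `(1 - β)ε` pays for the conversion; `α` is chosen to make its error
  -- exactly `δ`.
  have hδe : Real.exp (-((α - 1) * (ε - β * ε))) = δ := by
    have h1 : (α - 1) * (ε - β * ε) = Real.log (1 / δ) := by
      rw [hα]
      field_simp
      ring
    rw [h1, one_div, Real.log_inv, neg_neg, Real.exp_log hδ]
  have hexp : 3.5 * α * (α - 1) * γ₁ ^ 2 * t = (α - 1) * κ := by rw [hκ]; ring
  constructor
  · refine DPMAC.isDP_compositeCommunication fun τ τ' hτ K hK S hS => ?_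
    obtain ⟨l, hl, hPQ, hmom⟩ :=
      DPMAC.exists_messageLaw_density_rpow_le hv0 hC hγ0 hγ1 f hτ ht ht1 hα1 hc
    rw [hexp] at hmom
    have hcard : (Fintype.card K : ℝ) * κ ≤ β * ε := by
      rw [← hcomp, Fintype.card_coe, (Finset.mem_powersetCard.1 hK).2]
      exact mul_le_mul_of_nonneg_right (Nat.floor_le (by positivity)) hκ0.le
    have := DPMAC.pi_apply_le_exp_mul_add (ε := ε) hl hPQ hα1 hmom hcard hS
    rwa [hδe] at this
  · refine DPMAC.isDP_sharedCommunication hε.le hγ1 fun hN1 τ τ' hτ S hS => ?_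
    obtain ⟨l, hl, hPQ, hmom⟩ :=
      DPMAC.exists_messageLaw_density_rpow_le hv0 hC hγ0 hγ1 f hτ ht ht1 hα1 hc
    rw [hexp] at hmom
    have hκ1 : κ ≤ β * ε := by
      rw [← hcomp]
      exact le_mul_of_one_le_left hκ0.le hN1
    have := DPMAC.withDensity_apply_le_exp_mul_add (ε := ε) (η := β * ε) hl hα1
      (hmom.trans (ENNReal.ofReal_le_ofReal (Real.exp_le_exp.2
        (mul_le_mul_of_nonneg_left hκ1 (by linarith))))) hS
    rwa [hδe, ← hPQ] at this
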